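/- Let $\mathcal H$ be a real Hilbert space, let $\mathcal A_1:D(\mathcal A_1)\subset\mathcal H\to\mathcal H$ be a (possibly multivalued) maximal monotone operator with $0\in\mathcal A_1(0)$, and let $\mathcal F_1:\mathcal H\to\mathcal H$ be locally Lipschitz, i.e. for every $R\ge 0$ there is $L(R)\ge 0$ with $\|\mathcal F_1(U)-\mathcal F_1(V)\|\le L(R)\|U-V\|$ whenever $\|U\|,\|V\|\le R$. For $h\in L^1_{\rm loc}([0,\infty);\mathcal H)$ and $U_0\in\overline{D(\mathcal A_1)}$ consider the Cauchy problem $$U'+\mathcal A_1(U)+\mathcal F_1(U)\ni h,\qquad U(0)=U_0. \tag{P}$$ For $0<T<\infty$, a strong solution of the inclusion in $[0,T]$ is a function $U\in W^{1,\infty}(0,T;\mathcal H)$ (represented by a Lipschitz function on $[0,T]$) such that $U(t)\in D(\mathcal A_1)$ for all $t\in[0,T]$ and the inclusion holds a.e. in $(0,T)$. A generalized solution in $[0,T]$ is a limit in $C([0,T];\mathcal H)$ of strong solutions $u_n$ of the inclusions with right-hand sides $f_n\in L^1(0,T;\mathcal H)$, where $f_n\to h$ in $L^1(0,T;\mathcal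 H)$. For $T\in(0,\infty]$, a generalized solution in $[0,T)$ is a function that is a generalized solution in $[0,T']$ for every $T'\in(0,T)$; a generalized solution of (P) in $[0,T)$ is moreover required to satisfy $U(0)=U_0$, and it is maximal if it has no proper extension of the same kind. Let $U_0,U_{0n}\in\overline{D(\mathcal A_1)}$ ($n\in\mathbb N$) with $U_{0n}\to U_0$ in $\mathcal H$, and let $h,h_n\in L^1_{\rm loc}([0,\infty);\mathcal H)$ with $h_n\to h$ in $L^1_{\rm loc}([0,\infty);\mathcal H)$, i.e. in $L^1(0,T;\mathcal H)$ for every $T\in(0,\infty)$. Then (P) with data $(U_0,h)$, and likewise with data $(U_{0n},h_n)$ for each $n$, has a unique maximal generalized solution, denoted $U(U_0,h)$, respectively $U(U_{0n},h_n)$; let $[0,T_{\max}(U_0,h))$, respectively $[0,T_{\max}(U_{0n},h_n))$, be its domain, with right endpoint in $(0,\infty]$. Moreover: 1. $T_{\max}(U_0,h)\le\liminf_{n} T_{\max}(U_{0n},h_n)$; 2. for every $T^*\in(0,T_{\max}(U_0,h))$ one has $T^*<T_{\max}(U_{0n},h_n)$ for all sufficiently large $n$, and $U(U_{0n},h_n)\to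 U(U_0,h)$ in $C([0,T^*];\mathcal H)$. -/

import Mathlib

open Filter Topology MeasureTheory Set

/-- The domain `D(A)` of a multivalued operator `A` on `H`. -/
def operatorDomain {H : Type*} (A : H → Set H) : Set H :=
  {x | (A x).Nonempty}

/-- A multivalued operator on a real inner product space is monotone. -/
def IsMonotoneOperator {H : Type*} [NormedAddCommGroup H] [InnerProductSpace ℝ H]
    (A : H → Set H) : Prop :=
  ∀ x y, ∀ ξ ∈ A x, ∀ η ∈ A y, 0 ≤ inner ℝ (ξ - η) (x - y)

/-- A monotone operator that has no proper monotone extension (in the sense of graphs). -/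
def IsMaximalMonotoneOperator {H : Type*} [NormedAddCommGroup H] [InnerProductSpace ℝ H]
    (A : H → Set H) : Prop :=
  IsMonotoneOperator A ∧
    ∀ B : H → Set H, IsMonotoneOperator B → (∀ x, A x ⊆ B x) → ∀ x, B x ⊆ A x

/-- `F` is Lipschitz on every ball centered at the origin. -/
def IsLocallyLipschitzMap {H : Type*} [NormedAddCommGroup H] (F : H → H) : Prop :=
  ∀ R : ℝ, 0 ≤ R → ∃ L : ℝ, 0 ≤ L ∧
    ∀ U V : H, ‖U‖ ≤ R → ‖V‖ ≤ R → ‖F U - F V‖ ≤ L * ‖U - V‖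

/-- `U` is a strong solution of `U' + A(U) + F(U) ∋ h` in `[0,T]`: `U` is Lipschitz continuous
on `[0,T]` (that is, `U ∈ W^{1,∞}(0,T;H)`), `U(t) ∈ D(A)` for all `t ∈ [0,T]`, and the inclusion
holds for almost every `t ∈ (0,T)`. -/
structure IsStrongSolution {H : Type*} [NormedAddCommGroup H] [InnerProductSpace ℝ H]
    (A : H → Set H) (F : H → H) (h : ℝ → H) (T : ℝ) (U : ℝ → H) : Prop where
  lipschitz : ∃ K : NNReal, LipschitzOnWith K U (Icc 0 T)
  mem_domain : ∀ t ∈ Icc 0 T, U t ∈ operatorDomain A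
  inclusion : ∀ᵐ t ∂(volume : Measure ℝ), t ∈ Ioo 0 T →
    ∃ v : H, HasDerivAt U v t ∧ h t - v - F (U t) ∈ A (U t)

/-- `U` is a generalized solution of `U' + A(U) + F(U) ∋ h` in `[0,T]`: it is the limit in
`C([0,T];H)` of strong solutions `u n` of the problems with right-hand sides `f n`, where
`f n → h` in `L¹(0,T;H)`. -/
def IsGeneralizedSolution {H : Type*} [NormedAddCommGroup H] [InnerProductSpace ℝ H]
    (A : H → Set H) (F : H → H) (h : ℝ → H) (T : ℝ) (U : ℝ → H) : Prop :=
  ContinuousOn U (Icc 0 T) ∧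
    ∃ (f : ℕ → ℝ → H) (u : ℕ → ℝ → H),
      (∀ n, IntegrableOn (f n) (Icc 0 T)) ∧
      (∀ n, IsStrongSolution A F (f n) T (u n)) ∧
      Tendsto (fun n => ∫ t in Icc 0 T, ‖f n t - h t‖) atTop (𝓝 0) ∧
      TendstoUniformlyOn u U atTop (Icc 0 T)

/-- `U` is a generalized solution in `[0,T)`, `0 < T ≤ ∞`, of the Cauchy problem
`U' + A(U) + F(U) ∋ h`, `U(0) = U₀`. Only the values of `U` in `[0,T)` matter. -/
structure IsGeneralizedCauchySolution {H : Type*} [NormedAddCommGroup H] [InnerProductSpace ℝ H]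
    (A : H → Set H) (F : H → H) (h : ℝ → H) (U₀ : H) (T : EReal) (U : ℝ → H) : Prop where
  pos : 0 < T
  initial : U 0 = U₀
  solution : ∀ S : ℝ, 0 < S → (S : EReal) < T → IsGeneralizedSolution A F h S U

/-- `U` is a maximal generalized solution, with domain `[0,T)`, of the Cauchy problem:
it has no proper extension to a generalized solution in some `[0,S)`. -/
def IsMaximalGeneralizedSolution {H : Type*} [NormedAddCommGroup H] [InnerProductSpace ℝ H]
    (A : H → Set H) (F : H → H) (h : ℝ → H) (U₀ : H) (T : EReal) (U : ℝ → H) : Prop :=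
  IsGeneralizedCauchySolution A F h U₀ T U ∧
    ∀ (S : EReal) (V : ℝ → H), T ≤ S → IsGeneralizedCauchySolution A F h U₀ S V →
      (∀ t : ℝ, 0 ≤ t → (t : EReal) < T → V t = U t) → S = T

/-- The Cauchy problem has exactly one maximal generalized solution (as a function on its
domain `[0,T)`). -/
def HasUniqueMaximalGeneralizedSolution {H : Type*} [NormedAddCommGroup H]
    [InnerProductSpace ℝ H] (A : H → Set H) (F : H → H) (h : ℝ → H) (U₀ : H) : Prop :=
  ∃ (T : EReal) (U : ℝ → H), IsMaximalGeneralizedSolution A F h U₀ T U ∧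
    ∀ (S : EReal) (V : ℝ → H), IsMaximalGeneralizedSolution A F h U₀ S V →
      S = T ∧ ∀ t : ℝ, 0 ≤ t → (t : EReal) < T → V t = U t

/-! Truncation reduces everything to a globally Lipschitz perturbation on a fixed interval: `F ∘
ballRetraction R` is globally Lipschitz and equals `F` on the ball, and a solution staying strictly
inside the ball solves both problems (`IsGeneralizedSolution.congr_perturbation`).

For globally Lipschitz perturbations there are two ingredients. Stability: monotonicity discards `A`
from the derivative of `‖u - v‖`, and Gronwall bounds `‖u - v‖` by the initial distance plus the
`L¹` distance of the right-hand sides, times `exp (L * T)` (`IsStrongSolution.norm_sub_le`). The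
bound passes to generalized solutions and gives uniqueness, continuous dependence, and existence for
rough data by density. Existence for regular data (`exists_isStrongSolution`): Minty's theorem,
proved through the Fitzpatrick function, supplies resolvents; the Yosida approximation turns the
inclusion into an ODE; bounds uniform in the parameter make its solutions Cauchy. The limit is
Lipschitz, hence differentiable a.e., and maximality yields the inclusion wherever it is
differentiable.

Back to `F`: a solution on a closed interval always extends further
(`IsGeneralizedSolution.exists_extension`), so a maximal solution contains every other one. Given `T
< Tmax`, take the truncation radius larger than `sup ‖U‖ + 1` on `[0,T]`. The truncated problems
with perturbed data are solvable on all of `[0,T]` and their solutions converge uniformly to `U`.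
Eventually they lie inside the ball, so they solve the original problems and the perturbed lifespans
exceed `T`. The liminf bound follows since `T` is arbitrary. -/

/-! ### Maximal monotone operators and Minty's theorem -/

section MaximalMonotone

variable {H : Type*} [NormedAddCommGroup H] [InnerProductSpace ℝ H]

/-- Adjoining the single pair `(x, ξ)` to the graph keeps it monotone, so maximality forces the pair
to be there already. All later uses of maximality go through this criterion. -/
theorem IsMaximalMonotoneOperator.mem_of_forall_inner_nonneg {A : H → Set H}
    (hA : IsMaximalMonotoneOperator A) {x ξ : H}
    (h : ∀ y, ∀ η ∈ A y, 0 ≤ inner ℝ (ξ - η) (x - y)) : ξ ∈ A x := by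
  refine hA.2 (fun y => A y ∪ {η | y = x ∧ η = ξ}) ?_ (fun y => subset_union_left) x
    (Or.inr ⟨rfl, rfl⟩)
  rintro a b η (hη | ⟨rfl, rfl⟩) ζ (hζ | ⟨rfl, rfl⟩)
  · exact hA.1 _ _ _ hη _ hζ
  · have := h _ _ hη
    rwa [← neg_sub η, ← neg_sub a, inner_neg_neg] at this
  · exact h _ _ hζ
  · simp

/-- The epigraph of the Fitzpatrick function of the operator `A`. -/
def fitzpatrickEpigraph (A : H → Set H) : Set (H × H × ℝ) :=
  {p | ∀ y, ∀ η ∈ A y, inner ℝ p.1 η + inner ℝ y p.2.1 - inner ℝ y η ≤ p.2.2}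

theorem fitzpatrickEpigraph_convex (A : H → Set H) : Convex ℝ (fitzpatrickEpigraph A) := by
  intro p hp q hq a b ha hb hab y η hη
  have h1 := mul_le_mul_of_nonneg_left (hp y η hη) ha
  have h2 := mul_le_mul_of_nonneg_left (hq y η hη) hb
  have h3 : inner ℝ y η = a * inner ℝ y η + b * inner ℝ y η := by rw [← add_mul, hab, one_mul]
  simp only [Prod.fst_add, Prod.snd_add, Prod.smul_fst, Prod.smul_snd, inner_add_left,
    inner_add_right, inner_smul_left, inner_smul_right, smul_eq_mul, RCLike.conj_to_real]
  linarith

theorem fitzpatrickEpigraph_isClosed (A : H → Set H) : IsClosed (fitzpatrickEpigraph A) := by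
  simp only [fitzpatrickEpigraph, ofPred_forall]
  refine isClosed_iInter fun y => isClosed_iInter fun η => isClosed_iInter fun _ => ?_
  exact isClosed_le (by fun_prop) (by fun_prop)

theorem IsMonotoneOperator.mem_fitzpatrickEpigraph {A : H → Set H} (hA : IsMonotoneOperator A)
    {x ξ : H} (hx : ξ ∈ A x) : (x, ξ, inner ℝ x ξ) ∈ fitzpatrickEpigraph A := by
  intro y η hη
  have := hA _ _ _ hx _ hη
  simp only [inner_sub_left, inner_sub_right] at this
  rw [real_inner_comm x ξ, real_inner_comm y ξ, real_inner_comm x η, real_inner_comm y η] at this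
  dsimp only
  linarith

/-- A violation would make `(p.1, p.2.1)` monotonically related to the whole graph, hence a point of
it; testing the epigraph condition at that very point contradicts the violation. -/
theorem IsMaximalMonotoneOperator.inner_le_of_mem_fitzpatrickEpigraph {A : H → Set H}
    (hA : IsMaximalMonotoneOperator A) {p : H × H × ℝ} (hp : p ∈ fitzpatrickEpigraph A) :
    inner ℝ p.1 p.2.1 ≤ p.2.2 := by
  by_contra! hlt
  have hmem : p.2.1 ∈ A p.1 := by
    refine hA.mem_of_forall_inner_nonneg fun y η hη => ?_
    have := hp y η hη
    simp only [inner_sub_left, inner_sub_right]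
    rw [real_inner_comm p.1 p.2.1, real_inner_comm y p.2.1, real_inner_comm p.1 η,
      real_inner_comm y η]
    linarith
  have := hp _ _ hmem
  linarith

theorem nonneg_of_forall_add_sq_nonneg {a b : ℝ}
    (h : ∀ t : ℝ, 0 < t → t ≤ 1 → 0 ≤ t * a + t ^ 2 * b) : 0 ≤ a := by
  have h1 : ∀ᶠ t : ℝ in 𝓝[>] 0, 0 ≤ a + t * b := by
    filter_upwards [Ioo_mem_nhdsGT one_pos] with t ht
    have := h t ht.1 ht.2.le
    rw [show t * a + t ^ 2 * b = t * (a + t * b) by ring] at this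
    exact nonneg_of_mul_nonneg_right this ht.1
  have h2 : Tendsto (fun t : ℝ => a + t * b) (𝓝[>] 0) (𝓝 (a + 0 * b)) :=
    (Continuous.tendsto (by fun_prop) 0).mono_left nhdsWithin_le_nhds
  simpa using ge_of_tendsto h2 h1

/-- A closed convex set on which `2r + ‖x‖² + ‖ξ‖²` is bounded below contains a minimizer. -/
theorem exists_isMinOn_two_mul_add_norm_sq [CompleteSpace H] {C : Set (H × H × ℝ)}
    (hne : C.Nonempty) (hconv : Convex ℝ C) (hclosed : IsClosed C)
    (hbdd : ∀ p ∈ C, 0 ≤ 2 * p.2.2 + ‖p.1‖ ^ 2 + ‖p.2.1‖ ^ 2) :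
    ∃ p ∈ C, ∀ q ∈ C, 2 * p.2.2 + ‖p.1‖ ^ 2 + ‖p.2.1‖ ^ 2 ≤
      2 * q.2.2 + ‖q.1‖ ^ 2 + ‖q.2.1‖ ^ 2 := by
  set g : H × H × ℝ → ℝ := fun p => 2 * p.2.2 + ‖p.1‖ ^ 2 + ‖p.2.1‖ ^ 2 with hg
  set m := sInf (g '' C) with hm
  have hbd : BddBelow (g '' C) := ⟨0, by rintro _ ⟨p, hp, rfl⟩; exact hbdd p hp⟩
  have hmle : ∀ p ∈ C, m ≤ g p := fun p hp => csInf_le hbd ⟨p, hp, rfl⟩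
  have hex : ∀ n : ℕ, ∃ p ∈ C, g p < m + 1 / (n + 1) := by
    intro n
    obtain ⟨_, ⟨p, hp, rfl⟩, hlt⟩ := exists_lt_of_csInf_lt (hne.image g)
      (show sInf (g '' C) < m + 1 / ((n : ℝ) + 1) by rw [← hm]; linarith [Nat.one_div_pos_of_nat (α := ℝ) (n := n)])
    exact ⟨p, hp, hlt⟩
  choose p hpC hpm using hex
  -- Parallelogram law at the midpoint: near-minimizers are close in their two vector components.
  -- The scalar component then converges because it is determined by these and by the value of `g`.
  have hgap : ∀ a ∈ C, ∀ b ∈ C,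
      ‖a.1 - b.1‖ ^ 2 + ‖a.2.1 - b.2.1‖ ^ 2 ≤ 2 * (g a - m) + 2 * (g b - m) := by
    intro a ha b hb
    have hmid := hmle _ (hconv ha hb (show (0 : ℝ) ≤ 1 / 2 by norm_num)
      (show (0 : ℝ) ≤ 1 / 2 by norm_num) (by norm_num))
    simp only [hg, Prod.fst_add, Prod.snd_add, Prod.smul_fst, Prod.smul_snd, ← smul_add, norm_smul,
      smul_eq_mul, mul_pow] at hmid
    norm_num at hmid
    have h1 := parallelogram_law_with_norm ℝ a.1 b.1
    have h2 := parallelogram_law_with_norm ℝ a.2.1 b.2.1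
    simp only [hg]
    nlinarith
  have hcauchy : ∀ q : ℕ → H, (∀ i j, ‖q i - q j‖ ^ 2 ≤ 2 * (g (p i) - m) + 2 * (g (p j) - m)) →
      CauchySeq q := by
    intro q hq
    rw [Metric.cauchySeq_iff']
    intro ε hε
    obtain ⟨N, hN⟩ := exists_nat_one_div_lt (show (0 : ℝ) < ε ^ 2 / 4 by positivity)
    refine ⟨N, fun n hn => ?_⟩
    rw [dist_eq_norm]
    have h1 := hq n N
    have h2 : (1 : ℝ) / (n + 1) ≤ 1 / (N + 1) := Nat.one_div_le_one_div hn
    have h3 := hpm n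
    have h4 := hpm N
    exact lt_of_pow_lt_pow_left₀ 2 hε.le (by linarith)
  obtain ⟨x, hx⟩ := cauchySeq_tendsto_of_complete (hcauchy (fun n => (p n).1) fun i j => by
    have := hgap _ (hpC i) _ (hpC j)
    linarith [sq_nonneg ‖(p i).2.1 - (p j).2.1‖])
  obtain ⟨ξ, hξ⟩ := cauchySeq_tendsto_of_complete (hcauchy (fun n => (p n).2.1) fun i j => by
    have := hgap _ (hpC i) _ (hpC j)
    linarith [sq_nonneg ‖(p i).1 - (p j).1‖])
  have hgm : Tendsto (fun n => g (p n)) atTop (𝓝 m) := by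
    refine tendsto_of_tendsto_of_tendsto_of_le_of_le tendsto_const_nhds ?_
      (fun n => hmle _ (hpC n)) (fun n => (hpm n).le)
    simpa using tendsto_const_nhds.add (tendsto_one_div_add_atTop_nhds_zero_nat (𝕜 := ℝ))
  have hr : Tendsto (fun n => (p n).2.2) atTop (𝓝 ((m - ‖x‖ ^ 2 - ‖ξ‖ ^ 2) / 2)) := by
    have := ((hgm.sub (hx.norm.pow 2)).sub (hξ.norm.pow 2)).div_const 2
    refine this.congr fun n => ?_
    simp only [hg]
    ring
  refine ⟨(x, ξ, (m - ‖x‖ ^ 2 - ‖ξ‖ ^ 2) / 2), hclosed.mem_of_tendsto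
    (hx.prodMk_nhds (hξ.prodMk_nhds hr)) (Eventually.of_forall hpC), fun q hq => ?_⟩
  have := hmle q hq
  simp only [hg] at this
  linarith

/-- Minty's theorem: `0` is in the range of `I + A`. -/
theorem IsMaximalMonotoneOperator.exists_neg_self_mem [CompleteSpace H] {A : H → Set H}
    (hA : IsMaximalMonotoneOperator A) (hne : ∃ x, (A x).Nonempty) : ∃ x, -x ∈ A x := by
  have key : ∀ p : H × H × ℝ, ‖p.1 + p.2.1‖ ^ 2 =
      2 * inner ℝ p.1 p.2.1 + ‖p.1‖ ^ 2 + ‖p.2.1‖ ^ 2 := fun p => by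
    rw [norm_add_sq_real]; ring
  obtain ⟨y₀, η₀, hη₀⟩ := hne
  obtain ⟨p, hp, hmin⟩ := exists_isMinOn_two_mul_add_norm_sq
    ⟨_, hA.1.mem_fitzpatrickEpigraph hη₀⟩ (fitzpatrickEpigraph_convex A)
    (fitzpatrickEpigraph_isClosed A) (fun p hp => by
      have := hA.inner_le_of_mem_fitzpatrickEpigraph hp
      have h2 := key p
      nlinarith [sq_nonneg ‖p.1 + p.2.1‖])
  have hle := hA.inner_le_of_mem_fitzpatrickEpigraph hp
  -- First variation of the minimum towards the epigraph point of a graph element. It puts `(-p.2.1,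
  -- -p.1)` in the graph, and choosing that pair as `(y, η)` then gives `p.1 + p.2.1 = 0`.
  have hvar : ∀ y, ∀ η ∈ A y, ‖p.1 + p.2.1‖ ^ 2 ≤ inner ℝ (η + p.1) (y + p.2.1) := by
    intro y η hη
    have hq := hA.1.mem_fitzpatrickEpigraph hη
    have h0 : 0 ≤ 2 * (inner ℝ y η - p.2.2) + 2 * inner ℝ p.1 (y - p.1)
        + 2 * inner ℝ p.2.1 (η - p.2.1) := by
      refine nonneg_of_forall_add_sq_nonneg
        (b := ‖y - p.1‖ ^ 2 + ‖η - p.2.1‖ ^ 2) fun t ht ht1 => ?_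
      have h1 := hmin _ (fitzpatrickEpigraph_convex A hp hq (sub_nonneg.2 ht1) ht.le
        (sub_add_cancel 1 t))
      simp only [Prod.fst_add, Prod.snd_add, Prod.smul_fst, Prod.smul_snd, smul_eq_mul] at h1
      rw [show (1 - t) • p.1 + t • y = p.1 + t • (y - p.1) by module,
        show (1 - t) • p.2.1 + t • η = p.2.1 + t • (η - p.2.1) by module,
        norm_add_sq_real p.1, norm_add_sq_real p.2.1, norm_smul, norm_smul, mul_pow, mul_pow,
        Real.norm_eq_abs, sq_abs, inner_smul_right, inner_smul_right] at h1
      linarith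
    have h2 := key p
    simp only [inner_sub_right, inner_add_right, inner_add_left, real_inner_self_eq_norm_sq] at h0 ⊢
    rw [real_inner_comm y η, real_inner_comm p.2.1 η]
    linarith
  have hmem : -p.1 ∈ A (-p.2.1) := by
    refine hA.mem_of_forall_inner_nonneg fun y η hη => ?_
    have := (sq_nonneg _).trans (hvar y η hη)
    rwa [← inner_neg_neg, neg_add', neg_add', sub_eq_add_neg, add_comm, ← sub_eq_add_neg,
      sub_eq_add_neg (-y), add_comm (-y), ← sub_eq_add_neg] at this
  have hzero : p.1 + p.2.1 = 0 := by
    have := hvar _ _ hmem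
    simpa using this
  rw [eq_neg_of_add_eq_zero_right hzero, neg_neg] at hmem
  exact ⟨_, hmem⟩

/-- Translation by `z` and scaling by `c` preserve maximal monotonicity, so Minty's theorem at `0`
gives surjectivity of `I + c A`. -/
theorem IsMaximalMonotoneOperator.exists_resolvent [CompleteSpace H] {A : H → Set H}
    (hA : IsMaximalMonotoneOperator A) (hne : ∃ x, (A x).Nonempty) {c : ℝ} (hc : 0 < c) (z : H) :
    ∃ y, c⁻¹ • (z - y) ∈ A y := by
  have hB : IsMaximalMonotoneOperator fun w => {η | c⁻¹ • η ∈ A (w + z)} := by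
    refine ⟨fun x y ξ hξ η hη => ?_, fun B hB hAB x ξ hξ => ?_⟩
    · have := hA.1 _ _ _ hξ _ hη
      rw [← smul_sub, inner_smul_left, add_sub_add_right_eq_sub, RCLike.conj_to_real] at this
      exact nonneg_of_mul_nonneg_right this (inv_pos.2 hc)
    · refine hA.mem_of_forall_inner_nonneg fun y η hη => ?_
      have h1 : c • η ∈ B (y - z) := hAB _ (by simpa [smul_smul, hc.ne'] using hη)
      have h2 := hB _ _ _ hξ _ h1
      rw [show ξ - c • η = c • (c⁻¹ • ξ - η) by rw [smul_sub, smul_inv_smul₀ hc.ne'],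
        inner_smul_left, RCLike.conj_to_real, show x - (y - z) = x + z - y by abel] at h2
      exact nonneg_of_mul_nonneg_right h2 hc
  obtain ⟨y₀, η₀, hη₀⟩ := hne
  obtain ⟨w, hw⟩ := hB.exists_neg_self_mem
    ⟨y₀ - z, c • η₀, by simpa [smul_smul, hc.ne'] using hη₀⟩
  exact ⟨w + z, by simpa using hw⟩

end MaximalMonotone

/-! ### Weak compactness along ultrafilters -/

section WeakLimits

/-- Bounded families in a Hilbert space converge weakly along ultrafilters. -/
theorem exists_tendsto_inner_of_bounded {H : Type*} [NormedAddCommGroup H] [InnerProductSpace ℝ H]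
    [CompleteSpace H] {ι : Type*} (𝒰 : Ultrafilter ι) {y : ι → H} {C : ℝ}
    (hy : ∀ i, ‖y i‖ ≤ C) :
    ∃ x : H, ∀ z, Tendsto (fun i => inner ℝ (y i) z) 𝒰 (𝓝 (inner ℝ x z)) := by
  set φ : ι → WeakDual ℝ H :=
    fun i => StrongDual.toWeakDual (InnerProductSpace.toDual ℝ H (y i)) with hφ
  have hcomp := WeakDual.isCompact_closedBall (𝕜 := ℝ) (0 : StrongDual ℝ H) C
  obtain ⟨ψ, -, hψ⟩ := hcomp.ultrafilter_le_nhds (𝒰.map φ) (by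
    rw [le_principal_iff, Ultrafilter.coe_map]
    exact mem_map.2 (Eventually.of_forall fun i => by simp [hφ, hy i]))
  refine ⟨(InnerProductSpace.toDual ℝ H).symm (WeakDual.toStrongDual ψ), fun z => ?_⟩
  rw [InnerProductSpace.toDual_symm_apply]
  have h1 : Tendsto φ 𝒰 (𝓝 ψ) := hψ
  exact ((WeakDual.eval_continuous z).tendsto ψ).comp h1

end WeakLimits

/-! ### Resolvents and Yosida approximation -/

section Yosida

variable {H : Type*} [NormedAddCommGroup H] [InnerProductSpace ℝ H]

/-- The value at `z` of the resolvent `(I + c A)⁻¹`. -/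
noncomputable def resolventMap (A : H → Set H) (c : ℝ) (z : H) : H :=
  Classical.epsilon fun y => c⁻¹ • (z - y) ∈ A y

/-- The Yosida approximation of `A`. -/
noncomputable def yosidaMap (A : H → Set H) (c : ℝ) (z : H) : H :=
  c⁻¹ • (z - resolventMap A c z)

theorem resolventMap_eq_sub {A : H → Set H} {c : ℝ} (hc : 0 < c) (z : H) :
    resolventMap A c z = z - c • yosidaMap A c z := by
  rw [yosidaMap, smul_inv_smul₀ hc.ne', sub_sub_cancel]

variable [CompleteSpace H]

/-- The graph is closed for strong convergence of points and weak convergence of values: the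
monotonicity inequality survives this mixed limit. -/
theorem IsMaximalMonotoneOperator.mem_domain_of_tendsto {A : H → Set H}
    (hA : IsMaximalMonotoneOperator A) {x : H} {u ξ : ℕ → H} {C : ℝ} (hξ : ∀ n, ξ n ∈ A (u n))
    (hC : ∀ n, ‖ξ n‖ ≤ C) (hu : Tendsto u atTop (𝓝 x)) : x ∈ operatorDomain A := by
  obtain ⟨ζ, hζ⟩ := exists_tendsto_inner_of_bounded (Ultrafilter.of atTop) hC
  refine ⟨ζ, hA.mem_of_forall_inner_nonneg fun y η hη => ?_⟩
  have hu' : Tendsto u (Ultrafilter.of (atTop : Filter ℕ)) (𝓝 x) := hu.mono_left (Ultrafilter.of_le _)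
  have h1 : Tendsto (fun n => inner ℝ (ξ n) (u n - x)) (Ultrafilter.of (atTop : Filter ℕ))
      (𝓝 0) := by
    have h0 : Tendsto (fun n => C * ‖u n - x‖) (Ultrafilter.of (atTop : Filter ℕ)) (𝓝 0) := by
      simpa using (tendsto_iff_norm_sub_tendsto_zero.1 hu').const_mul C
    refine squeeze_zero_norm (fun n => ?_) h0
    exact (norm_inner_le_norm _ _).trans (mul_le_mul_of_nonneg_right (hC n) (norm_nonneg _))
  have h2 := (h1.add (hζ (x - y))).sub ((hu'.sub_const y).inner (tendsto_const_nhds (x := η)))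
  rw [zero_add, real_inner_comm η, ← inner_sub_left] at h2
  refine ge_of_tendsto h2 (Eventually.of_forall fun n => ?_)
  have := hA.1 _ _ _ (hξ n) _ hη
  rwa [← inner_add_right, sub_add_sub_cancel, real_inner_comm η, ← inner_sub_left]

variable {A : H → Set H} {c : ℝ}

theorem IsMaximalMonotoneOperator.yosidaMap_mem (hA : IsMaximalMonotoneOperator A)
    (hne : ∃ x, (A x).Nonempty) (hc : 0 < c) (z : H) :
    yosidaMap A c z ∈ A (resolventMap A c z) :=
  Classical.epsilon_spec (hA.exists_resolvent hne hc z)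

/-- Cocoercivity: monotonicity of `A` at the two resolvent points, rewritten by
`resolventMap_eq_sub`. Monotonicity and the Lipschitz constant `c⁻¹` of the Yosida map both follow.
-/
theorem IsMaximalMonotoneOperator.norm_sq_yosidaMap_sub_le (hA : IsMaximalMonotoneOperator A)
    (hne : ∃ x, (A x).Nonempty) (hc : 0 < c) (x y : H) :
    c * ‖yosidaMap A c x - yosidaMap A c y‖ ^ 2 ≤
      inner ℝ (yosidaMap A c x - yosidaMap A c y) (x - y) := by
  have h := hA.1 _ _ _ (hA.yosidaMap_mem hne hc x) _ (hA.yosidaMap_mem hne hc y)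
  rw [resolventMap_eq_sub hc, resolventMap_eq_sub hc,
    show x - c • yosidaMap A c x - (y - c • yosidaMap A c y) =
      (x - y) - c • (yosidaMap A c x - yosidaMap A c y) by module,
    inner_sub_right, inner_smul_right, real_inner_self_eq_norm_sq] at h
  linarith

theorem IsMaximalMonotoneOperator.yosidaMap_inner_nonneg (hA : IsMaximalMonotoneOperator A)
    (hne : ∃ x, (A x).Nonempty) (hc : 0 < c) (x y : H) :
    0 ≤ inner ℝ (yosidaMap A c x - yosidaMap A c y) (x - y) :=
  (by positivity : (0 : ℝ) ≤ c * ‖yosidaMap A c x - yosidaMap A c y‖ ^ 2).trans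
    (hA.norm_sq_yosidaMap_sub_le hne hc x y)

theorem IsMaximalMonotoneOperator.yosidaMap_lipschitz (hA : IsMaximalMonotoneOperator A)
    (hne : ∃ x, (A x).Nonempty) (hc : 0 < c) (x y : H) :
    ‖yosidaMap A c x - yosidaMap A c y‖ ≤ c⁻¹ * ‖x - y‖ := by
  have h1 := (hA.norm_sq_yosidaMap_sub_le hne hc x y).trans (real_inner_le_norm _ _)
  set a := ‖yosidaMap A c x - yosidaMap A c y‖
  rcases (norm_nonneg _ : 0 ≤ a).eq_or_lt with h0 | h0
  · rw [show a = 0 from h0.symm]; positivity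
  · rw [inv_mul_eq_div, le_div_iff₀ hc]
    exact le_of_mul_le_mul_left (by linarith) h0

/-- Monotonicity between the resolvent point and `x` itself. The bound does not depend on `c`, which
is what makes the initial velocities uniformly bounded. -/
theorem IsMaximalMonotoneOperator.norm_yosidaMap_le (hA : IsMaximalMonotoneOperator A)
    (hc : 0 < c) {x ξ : H} (hξ : ξ ∈ A x) :
    ‖yosidaMap A c x‖ ≤ ‖ξ‖ := by
  have h := hA.1 _ _ _ (hA.yosidaMap_mem ⟨x, ξ, hξ⟩ hc x) _ hξ
  rw [resolventMap_eq_sub hc, sub_sub_cancel_left, inner_neg_right, inner_smul_right,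
    inner_sub_left, real_inner_self_eq_norm_sq, ← mul_neg, neg_sub] at h
  have h1 := nonneg_of_mul_nonneg_right h hc
  have h2 := real_inner_le_norm ξ (yosidaMap A c x)
  rcases (norm_nonneg (yosidaMap A c x)).eq_or_lt with h0 | h0
  · rw [← h0]; positivity
  · exact le_of_mul_le_mul_right (by nlinarith) h0

end Yosida

/-! ### Almost everywhere differentiability of Hilbert-valued Lipschitz functions -/

section AeDifferentiable

variable {H : Type*} [NormedAddCommGroup H] [InnerProductSpace ℝ H] [CompleteSpace H]

/-- After translating the variable, the integral is the difference of the means of `u` over short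
intervals starting at `t` and at `a`. -/
theorem tendsto_integral_difference_quotient {u : ℝ → H} (hu : Continuous u) (a t : ℝ) :
    Tendsto (fun n : ℕ => ∫ s in a..t, ((n : ℝ) + 1) • (u (s + 1 / ((n : ℝ) + 1)) - u s))
      atTop (𝓝 (u t - u a)) := by
  have hF : ∀ s, Tendsto (fun n : ℕ => ((n : ℝ) + 1) •
      ((∫ τ in (0 : ℝ)..(s + 1 / ((n : ℝ) + 1)), u τ) - ∫ τ in (0 : ℝ)..s, u τ))
      atTop (𝓝 (u s)) := by
    intro s
    have h1 := (intervalIntegral.integral_hasDerivAt_right (hu.intervalIntegrable 0 s)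
      hu.aestronglyMeasurable.stronglyMeasurableAtFilter hu.continuousAt).tendsto_slope_zero
    have h2 : Tendsto (fun n : ℕ => 1 / ((n : ℝ) + 1)) atTop (𝓝[≠] 0) :=
      tendsto_nhdsWithin_iff.2 ⟨tendsto_one_div_add_atTop_nhds_zero_nat, Eventually.of_forall
        fun n => (Nat.one_div_pos_of_nat (α := ℝ)).ne'⟩
    exact (h1.comp h2).congr fun n => by simp
  refine ((hF t).sub (hF a)).congr fun n => ?_
  have hi : ∀ x y, IntervalIntegrable u volume x y := fun x y => hu.intervalIntegrable x y
  rw [intervalIntegral.integral_smul, intervalIntegral.integral_sub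
    (Continuous.intervalIntegrable (by fun_prop) _ _) (hi _ _),
    intervalIntegral.integral_comp_add_right, ← smul_sub,
    ← intervalIntegral.integral_interval_sub_left (hi 0 (t + 1 / ((n : ℝ) + 1)))
      (hi 0 (a + 1 / ((n : ℝ) + 1))),
    ← intervalIntegral.integral_interval_sub_left (hi 0 t) (hi 0 a)]
  congr 1
  abel

/-- Lipschitz functions with values in a Hilbert space are differentiable almost everywhere. -/
theorem LipschitzWith.ae_exists_hasDerivAt {K : NNReal} {u : ℝ → H} (hu : LipschitzWith K u)
    (a b : ℝ) : ∀ᵐ t, t ∈ Ioo a b → ∃ v, HasDerivAt u v t := by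
  set μ : Measure ℝ := volume.restrict (Icc a b) with hμ
  set D : ℕ → ℝ → H := fun n s => ((n : ℝ) + 1) • (u (s + 1 / ((n : ℝ) + 1)) - u s) with hD
  have hDc : ∀ n, Continuous (D n) := fun n => by
    have := hu.continuous
    simp only [hD]; fun_prop
  have hDb : ∀ n s, ‖D n s‖ ≤ K := by
    intro n s
    have h0 : (0 : ℝ) < n + 1 := by positivity
    have h1 := hu.norm_sub_le (s + 1 / ((n : ℝ) + 1)) s
    rw [add_sub_cancel_left, Real.norm_of_nonneg (by positivity), mul_one_div,
      le_div_iff₀ h0] at h1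
    rw [hD, norm_smul, Real.norm_of_nonneg h0.le, mul_comm]
    exact h1
  have hDm : ∀ n, MemLp (D n) 2 μ := fun n =>
    MemLp.of_bound (hDc n).aestronglyMeasurable K (Eventually.of_forall (hDb n))
  -- `v` is a weak `L²` limit of the difference quotients. Pairing with indicators shows that `u` is
  -- a primitive of `v`, and Lebesgue differentiation concludes.
  obtain ⟨v, hv⟩ := exists_tendsto_inner_of_bounded (Ultrafilter.of (atTop : Filter ℕ))
    (y := fun n => (hDm n).toLp (D n)) (C := measureUnivNNReal μ ^ (2 : ENNReal).toReal⁻¹ * K)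
    (fun n => Lp.norm_le_of_ae_bound K.2 (by
      filter_upwards [(hDm n).coeFn_toLp] with s hs
      rw [hs]; exact hDb n s))
  have hvi : Integrable v μ := (Lp.memLp v).integrable one_le_two
  have hint : ∀ t ∈ Icc a b, ∫ s in a..t, v s = u t - u a := by
    intro t ht
    have hsub : ∀ g : ℝ → H, ∫ s in Ioc a t, g s ∂μ = ∫ s in a..t, g s := fun g => by
      rw [hμ, Measure.restrict_restrict measurableSet_Ioc, inter_eq_self_of_subset_left
        (show Ioc a t ⊆ Icc a b from fun s hs => ⟨hs.1.le, hs.2.trans ht.2⟩), intervalIntegral.integral_of_le ht.1]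
    refine ext_inner_left ℝ fun x => ?_
    have h1 := hv (indicatorConstLp 2 (measurableSet_Ioc (a := a) (b := t))
      (measure_ne_top μ _) x)
    have h2 : ∀ f : Lp H 2 μ, inner ℝ f (indicatorConstLp 2 (measurableSet_Ioc (a := a) (b := t))
        (measure_ne_top μ _) x) = inner ℝ x (∫ s in a..t, f s) := fun f => by
      rw [real_inner_comm, L2.inner_indicatorConstLp_eq_inner_setIntegral, hsub]
    simp only [h2] at h1
    have h3 := (tendsto_const_nhds (x := x)).inner (𝕜 := ℝ)
      ((tendsto_integral_difference_quotient hu.continuous a t).mono_left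
        (Ultrafilter.of_le atTop))
    refine tendsto_nhds_unique h1 (h3.congr fun n => ?_)
    congr 1
    rw [← hsub, ← hsub]
    exact integral_congr_ae (ae_restrict_of_ae ((hDm n).coeFn_toLp.symm))
  rcases le_or_gt b a with hab | hab
  · exact Eventually.of_forall fun t ht => absurd (ht.1.trans ht.2) hab.not_gt
  have hvI : IntervalIntegrable v volume a b := by
    rw [intervalIntegrable_iff_integrableOn_Icc_of_le hab.le]
    exact hvi
  filter_upwards [hvI.ae_hasDerivAt_integral] with t ht hmem
  have h1 := (ht (by rw [uIcc_of_le hab.le]; exact Ioo_subset_Icc_self hmem) a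
    left_mem_uIcc).const_add (u a)
  refine ⟨v t, h1.congr_of_eventuallyEq ?_⟩
  filter_upwards [Ioo_mem_nhds hmem.1 hmem.2] with s hs
  rw [hint s (Ioo_subset_Icc_self hs)]
  abel

end AeDifferentiable

/-! ### Radial retraction onto a ball -/

section BallRetraction

variable {H : Type*} [NormedAddCommGroup H] [NormedSpace ℝ H] {R : ℝ}

/-- The radial retraction onto the closed ball of radius `R`. -/
noncomputable def ballRetraction (R : ℝ) (x : H) : H := (R / max R ‖x‖) • x

theorem ballRetraction_of_norm_le (hR : 0 < R) {x : H} (hx : ‖x‖ ≤ R) :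
    ballRetraction R x = x := by
  rw [ballRetraction, max_eq_left hx, div_self hR.ne', one_smul]

theorem norm_ballRetraction (hR : 0 < R) (x : H) :
    ‖ballRetraction R x‖ = R / max R ‖x‖ * ‖x‖ := by
  rw [ballRetraction, norm_smul, Real.norm_of_nonneg (by positivity)]

theorem norm_ballRetraction_le (hR : 0 < R) (x : H) : ‖ballRetraction R x‖ ≤ R := by
  have h : 0 < max R ‖x‖ := lt_max_of_lt_left hR
  rw [norm_ballRetraction hR, div_mul_eq_mul_div, div_le_iff₀ h]
  exact mul_le_mul_of_nonneg_left (le_max_right _ _) hR.le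

theorem norm_ballRetraction_le_self (hR : 0 < R) (x : H) : ‖ballRetraction R x‖ ≤ ‖x‖ := by
  have h : 0 < max R ‖x‖ := lt_max_of_lt_left hR
  rw [norm_ballRetraction hR]
  exact mul_le_of_le_one_left (norm_nonneg _) ((div_le_one h).2 (le_max_left _ _))

theorem norm_ballRetraction_sub_le (hR : 0 < R) (x y : H) :
    ‖ballRetraction R x - ballRetraction R y‖ ≤ 2 * ‖x - y‖ := by
  have hx : 0 < max R ‖x‖ := lt_max_of_lt_left hR
  have hy : 0 < max R ‖y‖ := lt_max_of_lt_left hR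
  have h1 : ballRetraction R x - ballRetraction R y =
      (R / max R ‖x‖) • (x - y) + (R / max R ‖x‖ - R / max R ‖y‖) • y := by
    simp only [ballRetraction]; module
  have h2 : R / max R ‖x‖ ≤ 1 := (div_le_one hx).2 (le_max_left _ _)
  have h3 : |max R ‖y‖ - max R ‖x‖| ≤ ‖x - y‖ := by
    have := abs_max_sub_max_le_max R ‖y‖ R ‖x‖
    rw [sub_self, abs_zero, max_eq_right (a := (0 : ℝ)) (abs_nonneg _)] at this
    refine this.trans ?_
    rw [norm_sub_rev]
    exact abs_norm_sub_norm_le _ _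
  have h4 : |R / max R ‖x‖ - R / max R ‖y‖| * ‖y‖ ≤ ‖x - y‖ := by
    rw [show R / max R ‖x‖ - R / max R ‖y‖ =
      R / max R ‖x‖ * ((max R ‖y‖ - max R ‖x‖) / max R ‖y‖) by field_simp, abs_mul,
      abs_div _ (max R ‖y‖), abs_of_pos hy, abs_of_nonneg (by positivity : 0 ≤ R / max R ‖x‖), mul_assoc]
    calc R / max R ‖x‖ * (|max R ‖y‖ - max R ‖x‖| / max R ‖y‖ * ‖y‖)
        ≤ 1 * |max R ‖y‖ - max R ‖x‖| := by
          refine mul_le_mul h2 ?_ (by positivity) zero_le_one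
          rw [div_mul_eq_mul_div, div_le_iff₀ hy]
          exact mul_le_mul_of_nonneg_left (le_max_right _ _) (abs_nonneg _)
      _ ≤ ‖x - y‖ := by rwa [one_mul]
  rw [h1]
  refine (norm_add_le _ _).trans ?_
  rw [norm_smul, norm_smul, Real.norm_of_nonneg (by positivity), Real.norm_eq_abs]
  nlinarith [norm_nonneg (x - y)]

end BallRetraction

/-! ### Global solvability of Lipschitz ODEs -/

section ODE

variable {E : Type*} [NormedAddCommGroup E] [NormedSpace ℝ E] [CompleteSpace E]

/-- Global existence for ordinary differential equations with a globally Lipschitz right-hand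
side. -/
theorem exists_hasDerivWithinAt_Icc_of_lipschitz {f : ℝ → E → E} {T K : ℝ} (hT : 0 ≤ T)
    (hK : 0 ≤ K) (hfK : ∀ t ∈ Icc 0 T, ∀ x y, ‖f t x - f t y‖ ≤ K * ‖x - y‖)
    (hfc : ∀ x, ContinuousOn (f · x) (Icc 0 T)) (x₀ : E) :
    ∃ u : ℝ → E, u 0 = x₀ ∧ ∀ t ∈ Icc 0 T, HasDerivWithinAt u (f t (u t)) (Icc 0 T) t := by
  obtain ⟨C, hC⟩ := (isCompact_Icc (a := (0 : ℝ)) (b := T)).exists_bound_of_continuousOn (hfc 0)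
  have hC0 : 0 ≤ C := (norm_nonneg _).trans (hC 0 ⟨le_rfl, hT⟩)
  have hgrow : ∀ t ∈ Icc 0 T, ∀ x, ‖f t x‖ ≤ K * ‖x‖ + C := by
    intro t ht x
    have h1 := hfK t ht x 0
    rw [sub_zero] at h1
    have h2 := norm_sub_norm_le (f t x) (f t 0)
    linarith [hC t ht]
  obtain ⟨R₁, hR₁⟩ := (isCompact_Icc (a := (0 : ℝ)) (b := T)).exists_bound_of_continuousOn
    (f := gronwallBound ‖x₀‖ K C)
    (fun t _ => (hasDerivAt_gronwallBound ‖x₀‖ K C t).continuousAt.continuousWithinAt)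
  set R := max R₁ 1 with hR
  have hR0 : 0 < R := lt_max_of_lt_right one_pos
  -- The truncated field is bounded by `K * R + C`, so Picard–Lindelöf with radius `(K * R + C) * T`
  -- covers all of `[0,T]` at once. `R` dominates the Gronwall bound, so the truncation is never
  -- active.
  set g : ℝ → E → E := fun t x => f t (ballRetraction R x) with hg
  have hpic : IsPicardLindelof g (tmin := 0) (tmax := T) ⟨0, le_rfl, hT⟩ x₀
      ((K * R + C) * T).toNNReal 0 (K * R + C).toNNReal (K * 2).toNNReal := by
    refine ⟨fun t ht => ?_, fun x _ => hfc _, fun t ht x _ => ?_, ?_⟩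
    · refine (LipschitzWith.of_dist_le_mul fun x y => ?_).lipschitzOnWith
      rw [Real.coe_toNNReal _ (by positivity), dist_eq_norm, dist_eq_norm, mul_assoc]
      exact (hfK t ht _ _).trans
        (mul_le_mul_of_nonneg_left (norm_ballRetraction_sub_le hR0 x y) hK)
    · rw [Real.coe_toNNReal _ (by positivity)]
      exact (hgrow t ht _).trans (by
        have := mul_le_mul_of_nonneg_left (norm_ballRetraction_le hR0 x) hK
        linarith)
    · rw [Real.coe_toNNReal _ (by positivity), Real.coe_toNNReal _ (by positivity)]
      simp [hT]
  obtain ⟨u, hu0, hu⟩ := hpic.exists_eq_forall_mem_Icc_hasDerivWithinAt₀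
  have hbound : ∀ t ∈ Icc 0 T, ‖u t‖ ≤ gronwallBound ‖x₀‖ K C (t - 0) := by
    refine norm_le_gronwallBound_of_norm_deriv_right_le
      (fun t ht => (hu t ht).continuousWithinAt)
      (fun t ht => ((hu t ⟨ht.1, ht.2.le⟩).mono_of_mem_nhdsWithin
        (Icc_mem_nhdsGE_of_mem ht))) (by rw [← hu0]) fun t ht => ?_
    refine (hgrow t ⟨ht.1, ht.2.le⟩ _).trans ?_
    have := mul_le_mul_of_nonneg_left (norm_ballRetraction_le_self hR0 (u t)) hK
    linarith
  refine ⟨u, hu0, fun t ht => ?_⟩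
  have hle : ‖u t‖ ≤ R := by
    have h1 := hbound t ht
    rw [sub_zero] at h1
    exact h1.trans ((le_abs_self _).trans ((hR₁ t ht).trans (le_max_left _ _)))
  have h1 := hu t ht
  simp only [hg] at h1
  rwa [ballRetraction_of_norm_le hR0 hle] at h1

end ODE

/-! ### Differential inequalities -/

section DifferentialInequalities

theorem sub_le_mul_of_right_deriv_le {φ φ' : ℝ → ℝ} {a b C : ℝ} (hab : a ≤ b)
    (hφ : ContinuousOn φ (Icc a b)) (hφ' : ∀ t ∈ Ico a b, HasDerivWithinAt φ (φ' t) (Ici t) t)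
    (bound : ∀ t ∈ Ico a b, φ' t ≤ C) : φ b - φ a ≤ C * (b - a) := by
  have := image_le_of_deriv_right_le_deriv_boundary (B := fun s => φ a + C * (s - a))
    (B' := fun _ => C) hφ hφ' (by simp) (by fun_prop)
    (fun s _ => by
      have h1 := (((hasDerivAt_id s).sub_const a).const_mul C).const_add (φ a)
      simpa using h1.hasDerivWithinAt) bound (right_mem_Icc.2 hab)
  linarith

variable {H : Type*} [NormedAddCommGroup H] [InnerProductSpace ℝ H]

theorem norm_sq_le_gronwallBound {w w' : ℝ → H} {δ K ε T : ℝ} (hw : ContinuousOn w (Icc 0 T))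
    (hw' : ∀ t ∈ Ico 0 T, HasDerivWithinAt w (w' t) (Ici t) t) (h0 : ‖w 0‖ ^ 2 ≤ δ)
    (bound : ∀ t ∈ Ico 0 T, 2 * inner ℝ (w t) (w' t) ≤ K * ‖w t‖ ^ 2 + ε) :
    ∀ t ∈ Icc 0 T, ‖w t‖ ^ 2 ≤ gronwallBound δ K ε t := by
  intro t ht
  have := le_gronwallBound_of_liminf_deriv_right_le (f := fun s => ‖w s‖ ^ 2)
    (f' := fun s => 2 * inner ℝ (w s) (w' s)) (hw.norm.pow 2)
    (fun s hs r hr => (hw' s hs).norm_sq.liminf_right_slope_le hr) h0 bound t ht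
  rwa [sub_zero] at this

end DifferentialInequalities

/-! ### A priori estimates for the Yosida-regularized equation -/

section RegularizedProblem

variable {H : Type*} [NormedAddCommGroup H] [InnerProductSpace ℝ H]

/-- The derivative of a solution of `u' + P u = f` is controlled by its initial value when
`P + L` is monotone and `f` is Lipschitz. -/
theorem norm_deriv_sq_le_gronwallBound {P : H → H} {f u : ℝ → H} {K L T : ℝ} (hL : 0 ≤ L)
    (hP : ∀ x y, -(L * ‖x - y‖ ^ 2) ≤ inner ℝ (P x - P y) (x - y))
    (hf : ∀ s t, ‖f s - f t‖ ≤ K * |s - t|)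
    (hu : ∀ t ∈ Icc 0 (T + 1), HasDerivWithinAt u (f t - P (u t)) (Icc 0 (T + 1)) t) :
    ∀ t ∈ Icc 0 T,
      ‖f t - P (u t)‖ ^ 2 ≤ gronwallBound (‖f 0 - P (u 0)‖ ^ 2) (2 * L + 1) (K ^ 2) t := by
  have hright : ∀ t ∈ Ico 0 (T + 1), HasDerivWithinAt u (f t - P (u t)) (Ici t) t :=
    fun t ht => (hu t ⟨ht.1, ht.2.le⟩).mono_of_mem_nhdsWithin (Icc_mem_nhdsGE_of_mem ht)
  have hslope : ∀ t ∈ Ico 0 (T + 1),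
      Tendsto (fun h : ℝ => h⁻¹ • (u (t + h) - u t)) (𝓝[>] 0) (𝓝 (f t - P (u t))) := by
    intro t ht
    have h1 := (hasDerivWithinAt_iff_tendsto_slope' self_notMem_Ioi).1
      ((hright t ht).mono Ioi_subset_Ici_self)
    have h2 : Tendsto (fun h : ℝ => t + h) (𝓝[>] 0) (𝓝[>] t) := by
      refine tendsto_nhdsWithin_iff.2 ⟨?_, ?_⟩
      · exact Tendsto.mono_left (by simpa using (continuous_const_add t).tendsto 0)
          nhdsWithin_le_nhds
      · filter_upwards [self_mem_nhdsWithin] with h hh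
        simpa using hh
    refine (h1.comp h2).congr fun h => ?_
    simp [slope]
  intro t ht
  have hk : 2 * L + 1 ≠ 0 := by positivity
  have hT1 : T < T + 1 := lt_add_one T
  have h0 := hslope 0 ⟨le_rfl, (ht.1.trans ht.2).trans_lt hT1⟩
  have hlim : Tendsto (fun h : ℝ => gronwallBound (‖h⁻¹ • (u (0 + h) - u 0)‖ ^ 2) (2 * L + 1)
      (K ^ 2) t) (𝓝[>] 0) (𝓝 (gronwallBound (‖f 0 - P (u 0)‖ ^ 2) (2 * L + 1) (K ^ 2) t)) := by
    simp only [gronwallBound_of_K_ne_0 hk]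
    exact ((h0.norm.pow 2).mul_const _).add_const _
  refine le_of_tendsto_of_tendsto ((hslope t ⟨ht.1, ht.2.trans_lt hT1⟩).norm.pow 2) hlim ?_
  -- For a shift `h < 1` the translated solution still lives in `[0, T + 1]`. Gronwall is applied to
  -- the difference quotient, and then `h → 0`.
  filter_upwards [Ioo_mem_nhdsGT one_pos] with h hh
  have hmaps : ∀ s ∈ Icc 0 T, s + h ∈ Icc 0 (T + 1) := fun s hs =>
    ⟨add_nonneg hs.1 hh.1.le, add_le_add hs.2 hh.2.le⟩
  have hcont : ContinuousOn u (Icc 0 (T + 1)) := fun s hs => (hu s hs).continuousWithinAt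
  refine norm_sq_le_gronwallBound (w := fun s => h⁻¹ • (u (s + h) - u s))
    (w' := fun s => h⁻¹ • ((f (s + h) - P (u (s + h))) - (f s - P (u s))))
    (T := T) ?_ ?_ le_rfl ?_ t ht
  · refine ContinuousOn.const_smul (ContinuousOn.sub ?_ (hcont.mono
      (Icc_subset_Icc_right hT1.le))) _
    exact hcont.comp (by fun_prop) hmaps
  · intro s hs
    have h1 := hright (s + h) ⟨(hmaps s ⟨hs.1, hs.2.le⟩).1, add_lt_add hs.2 hh.2⟩
    have h2 : HasDerivWithinAt (fun x => u (x + h)) (f (s + h) - P (u (s + h))) (Ici s) s := by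
      have := h1.scomp s (((hasDerivAt_id s).add_const h).hasDerivWithinAt (s := Ici s))
        (fun x hx => by simpa using hx)
      rw [one_smul] at this
      exact this
    exact (h2.sub (hright s ⟨hs.1, hs.2.trans hT1⟩)).const_smul _
  · intro s hs
    have h1 := hP (u (s + h)) (u s)
    have h2 := hf (s + h) s
    rw [add_sub_cancel_left, abs_of_pos hh.1] at h2
    have h3 := (real_inner_le_norm (f (s + h) - f s) (u (s + h) - u s)).trans
      (mul_le_mul_of_nonneg_right h2 (norm_nonneg _))
    rw [show f (s + h) - P (u (s + h)) - (f s - P (u s)) =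
      (f (s + h) - f s) - (P (u (s + h)) - P (u s)) by abel]
    rw [inner_smul_left, inner_smul_right, norm_smul, mul_pow, RCLike.conj_to_real,
      real_inner_comm, inner_sub_left, Real.norm_eq_abs, sq_abs]
    set a := ‖u (s + h) - u s‖
    set i := h⁻¹
    have hih : i * h = 1 := inv_mul_cancel₀ hh.1.ne'
    have hi : 0 < i := inv_pos.2 hh.1
    have h4 : 2 * (i * (i * (inner ℝ (f (s + h) - f s) (u (s + h) - u s) -
        inner ℝ (P (u (s + h)) - P (u s)) (u (s + h) - u s)))) ≤
        2 * (i * (i * (K * h * a + L * a ^ 2))) := by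
      gcongr
      linarith
    refine h4.trans ?_
    have h5 : i * (i * (K * h * a)) = K * (i * a) := by
      rw [show i * (i * (K * h * a)) = (i * h) * (K * (i * a)) by ring, hih, one_mul]
    -- Young's inequality `2 K x ≤ K ^ 2 + x ^ 2` accounts for the `+ 1` in the rate and for the
    -- forcing `K ^ 2`.
    nlinarith [sq_nonneg (K - i * a)]

variable [CompleteSpace H]

/-- The point is that `M` precedes `c`. The initial velocity is at most `‖f 0‖ + ‖F u₀‖ + ‖ξ‖` for
any `ξ ∈ A u₀`, Gronwall propagates this bound, and the equation then bounds the Yosida term. -/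
theorem exists_solution_yosida {A : H → Set H} (hA : IsMaximalMonotoneOperator A) {F : H → H}
    {L : ℝ} (hL : 0 ≤ L) (hF : ∀ x y, ‖F x - F y‖ ≤ L * ‖x - y‖) {f : ℝ → H} {K : ℝ}
    (hK : 0 ≤ K) (hf : ∀ s t, ‖f s - f t‖ ≤ K * |s - t|) {T : ℝ} (hT : 0 ≤ T) {u₀ : H}
    (hu₀ : u₀ ∈ operatorDomain A) :
    ∃ M : ℝ, 0 ≤ M ∧ ∀ c : ℝ, 0 < c → ∃ u : ℝ → H, u 0 = u₀ ∧ ∀ t ∈ Icc 0 T,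
      HasDerivWithinAt u (f t - F (u t) - yosidaMap A c (u t)) (Icc 0 T) t ∧
      ‖f t - F (u t) - yosidaMap A c (u t)‖ ≤ M ∧ ‖yosidaMap A c (u t)‖ ≤ M := by
  obtain ⟨ξ, hξ⟩ := hu₀
  have hne : ∃ x, (A x).Nonempty := ⟨u₀, ξ, hξ⟩
  set N := ‖f 0‖ + ‖F u₀‖ + ‖ξ‖ with hN
  have hk : 2 * L + 1 ≠ 0 := by positivity
  set M₁ := Real.sqrt (gronwallBound (N ^ 2) (2 * L + 1) (K ^ 2) T) with hM₁
  have hfc : Continuous f := (LipschitzWith.of_dist_le_mul (K := K.toNNReal) fun s t => by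
    rw [Real.coe_toNNReal _ hK, dist_eq_norm, Real.dist_eq]; exact hf s t).continuous
  refine ⟨M₁ + (N + K * T + L * (M₁ * T)), by positivity, fun c hc => ?_⟩
  obtain ⟨u, hu0, hu⟩ := exists_hasDerivWithinAt_Icc_of_lipschitz
    (f := fun t x => f t - (F x + yosidaMap A c x)) (T := T + 1) (K := L + c⁻¹)
    (by positivity) (by positivity) (fun t _ x y => by
      rw [show f t - (F x + yosidaMap A c x) - (f t - (F y + yosidaMap A c y)) =
        -((F x - F y) + (yosidaMap A c x - yosidaMap A c y)) by abel, norm_neg, add_mul]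
      exact (norm_add_le _ _).trans (add_le_add (hF x y) (hA.yosidaMap_lipschitz hne hc x y)))
    (fun x => by fun_prop) u₀
  have hd := norm_deriv_sq_le_gronwallBound (P := fun x => F x + yosidaMap A c x) (K := K) hL
    (fun x y => by
      have h1 := hA.yosidaMap_inner_nonneg hne hc x y
      have h2 := (abs_le.1 (abs_real_inner_le_norm (F x - F y) (x - y))).1
      have h3 := mul_le_mul_of_nonneg_right (hF x y) (norm_nonneg (x - y))
      rw [add_sub_add_comm, inner_add_left]
      nlinarith) hf hu
  have hd' : ∀ t ∈ Icc 0 T, ‖f t - (F (u t) + yosidaMap A c (u t))‖ ≤ M₁ := by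
    intro t ht
    refine Real.le_sqrt_of_sq_le ((hd t ht).trans ?_)
    have h1 : ‖f 0 - (F (u 0) + yosidaMap A c (u 0))‖ ≤ N := by
      rw [hu0, ← sub_sub]
      refine (norm_sub_le _ _).trans (add_le_add (norm_sub_le _ _) (hA.norm_yosidaMap_le hc hξ))
    simp only [gronwallBound_of_K_ne_0 hk]
    have h2 : (0 : ℝ) < 2 * L + 1 := by positivity
    have h3 := ht.2
    gcongr
  have hsub : Icc 0 T ⊆ Icc 0 (T + 1) := Icc_subset_Icc_right (lt_add_one T).le
  have hder : ∀ t ∈ Icc 0 T,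
      HasDerivWithinAt u (f t - (F (u t) + yosidaMap A c (u t))) (Icc 0 T) t :=
    fun t ht => (hu t (hsub ht)).mono hsub
  refine ⟨u, hu0, fun t ht => ?_⟩
  rw [sub_sub]
  refine ⟨hder t ht, (hd' t ht).trans (le_add_of_nonneg_right (by positivity)), ?_⟩
  have h1 : ‖u t - u₀‖ ≤ M₁ * T := by
    have := (convex_Icc 0 T).norm_image_sub_le_of_norm_hasDerivWithin_le hder hd'
      (left_mem_Icc.2 hT) ht
    rw [hu0, sub_zero, Real.norm_of_nonneg ht.1] at this
    exact this.trans (mul_le_mul_of_nonneg_left ht.2 (Real.sqrt_nonneg _))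
  have h2 : ‖F (u t)‖ ≤ ‖F u₀‖ + L * (M₁ * T) := by
    have h3 := norm_sub_norm_le (F (u t)) (F u₀)
    have h4 := (hF (u t) u₀).trans (mul_le_mul_of_nonneg_left h1 hL)
    linarith
  have h5 : ‖f t‖ ≤ ‖f 0‖ + K * T := by
    have h3 := norm_sub_norm_le (f t) (f 0)
    have h4 := hf t 0
    rw [sub_zero, abs_of_nonneg ht.1] at h4
    have := mul_le_mul_of_nonneg_left ht.2 hK
    linarith
  have h6 : yosidaMap A c (u t) =
      f t - F (u t) - (f t - (F (u t) + yosidaMap A c (u t))) := by abel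
  rw [h6]
  refine (norm_sub_le _ _).trans ?_
  have h7 := norm_sub_le (f t) (F (u t))
  have h8 := hd' t ht
  have h9 := norm_nonneg ξ
  linarith

/-- Solutions of two Yosida-regularized problems with parameters `c` and `d` are close. -/
theorem norm_sq_sub_le_of_yosida {A : H → Set H} (hA : IsMaximalMonotoneOperator A)
    (hne : ∃ x, (A x).Nonempty) {F : H → H} {L : ℝ}
    (hF : ∀ x y, ‖F x - F y‖ ≤ L * ‖x - y‖) {f u v : ℝ → H} {T M c d : ℝ} (hc : 0 < c)
    (hd : 0 < d) (h0 : u 0 = v 0)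
    (hu : ∀ t ∈ Icc 0 T, HasDerivWithinAt u (f t - F (u t) - yosidaMap A c (u t)) (Icc 0 T) t)
    (hv : ∀ t ∈ Icc 0 T, HasDerivWithinAt v (f t - F (v t) - yosidaMap A d (v t)) (Icc 0 T) t)
    (huM : ∀ t ∈ Icc 0 T, ‖yosidaMap A c (u t)‖ ≤ M)
    (hvM : ∀ t ∈ Icc 0 T, ‖yosidaMap A d (v t)‖ ≤ M) :
    ∀ t ∈ Icc 0 T, ‖u t - v t‖ ^ 2 ≤
      gronwallBound 0 (2 * L + 1) ((c + d) * (4 * M ^ 2)) t := by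
  have hright : ∀ {w w' : ℝ → H}, (∀ t ∈ Icc 0 T, HasDerivWithinAt w (w' t) (Icc 0 T) t) →
      ∀ t ∈ Ico 0 T, HasDerivWithinAt w (w' t) (Ici t) t := fun hw t ht =>
    (hw t ⟨ht.1, ht.2.le⟩).mono_of_mem_nhdsWithin (Icc_mem_nhdsGE_of_mem ht)
  refine norm_sq_le_gronwallBound (w := fun s => u s - v s)
    (ContinuousOn.sub (fun s hs => (hu s hs).continuousWithinAt)
      (fun s hs => (hv s hs).continuousWithinAt))
    (fun s hs => (hright hu s hs).sub (hright hv s hs)) (by simp [h0]) fun s hs => ?_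
  have hs' : s ∈ Icc 0 T := ⟨hs.1, hs.2.le⟩
  -- Monotonicity holds at the resolvents, not at `u s` and `v s`; the discrepancy `c • y - d • z`
  -- has norm at most `(c + d) * M`, which produces the forcing term.
  have hmono := hA.1 _ _ _ (hA.yosidaMap_mem hne hc (u s)) _ (hA.yosidaMap_mem hne hd (v s))
  rw [resolventMap_eq_sub hc, resolventMap_eq_sub hd] at hmono
  have h1 := huM s hs'
  have h2 := hvM s hs'
  set y := yosidaMap A c (u s)
  set z := yosidaMap A d (v s)
  have hM : 0 ≤ M := (norm_nonneg _).trans h1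
  rw [show u s - c • y - (v s - d • z) = (u s - v s) - (c • y - d • z) by abel,
    inner_sub_right] at hmono
  have h3 : |inner ℝ (y - z) (c • y - d • z)| ≤ (2 * M) * ((c + d) * M) := by
    refine (abs_real_inner_le_norm _ _).trans (mul_le_mul ?_ ?_ (norm_nonneg _) (by positivity))
    · exact (norm_sub_le _ _).trans (by linarith)
    · refine (norm_sub_le _ _).trans ?_
      rw [norm_smul, norm_smul, Real.norm_of_nonneg hc.le, Real.norm_of_nonneg hd.le, add_mul]
      gcongr
  have h4 := (abs_le.1 h3).1
  have h5 := (abs_le.1 (abs_real_inner_le_norm (F (u s) - F (v s)) (u s - v s))).1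
  have h6 := mul_le_mul_of_nonneg_right (hF (u s) (v s)) (norm_nonneg (u s - v s))
  rw [show f s - F (u s) - y - (f s - F (v s) - z) =
    -((F (u s) - F (v s)) + (y - z)) by abel, inner_neg_right, real_inner_comm, inner_add_left]
  nlinarith [sq_nonneg ‖u s - v s‖]

/-- One-sided estimate on the solutions of the Yosida-regularized problem, tested against a point
of the graph of `A`. -/
theorem two_mul_inner_yosida_le {A : H → Set H} (hA : IsMaximalMonotoneOperator A) {x y η g : H}
    (hη : η ∈ A y) {c M : ℝ} (hc : 0 < c) (hM : ‖yosidaMap A c x‖ ≤ M) :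
    2 * inner ℝ (x - y) (g - yosidaMap A c x) ≤
      2 * inner ℝ (g - η) (x - y) + c * (2 * (M * ‖η‖)) := by
  have h := hA.1 _ _ _ (hA.yosidaMap_mem ⟨y, η, hη⟩ hc x) _ hη
  rw [resolventMap_eq_sub hc] at h
  set z := yosidaMap A c x
  rw [sub_right_comm, inner_sub_right, inner_smul_right, inner_sub_left z η z,
    real_inner_self_eq_norm_sq] at h
  have h1 := (real_inner_le_norm η z).trans (mul_le_mul_of_nonneg_left hM (norm_nonneg η))
  have h2 := mul_le_mul_of_nonneg_left h1 hc.le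
  have h3 : 0 ≤ c * ‖z‖ ^ 2 := by positivity
  rw [real_inner_comm, inner_sub_left g z, inner_sub_left g η]
  rw [inner_sub_left z η] at h
  nlinarith

end RegularizedProblem

/-! ### Strong solutions as limits of regularized ones -/

section StrongExistence

variable {H : Type*} [NormedAddCommGroup H] [InnerProductSpace ℝ H] [CompleteSpace H]

/-- The limit of solutions of Yosida-regularized problems satisfies the inclusion wherever it is
differentiable. -/
theorem IsMaximalMonotoneOperator.mem_of_yosida_limit {A : H → Set H}
    (hA : IsMaximalMonotoneOperator A) {F : H → H} (hF : Continuous F) {f : ℝ → H}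
    (hf : Continuous f) {T M : ℝ} (hM : 0 ≤ M) {c : ℕ → ℝ} (hc : ∀ n, 0 < c n)
    (hc_lim : Tendsto c atTop (𝓝 0)) {u : ℕ → ℝ → H} {V : ℝ → H}
    (hu : ∀ n, ∀ t ∈ Icc 0 T,
      HasDerivWithinAt (u n) (f t - F (u n t) - yosidaMap A (c n) (u n t)) (Icc 0 T) t)
    (huM : ∀ n, ∀ t ∈ Icc 0 T, ‖f t - F (u n t) - yosidaMap A (c n) (u n t)‖ ≤ M)
    (hyM : ∀ n, ∀ t ∈ Icc 0 T, ‖yosidaMap A (c n) (u n t)‖ ≤ M)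
    (hV : ∀ t ∈ Icc 0 T, Tendsto (fun n => u n t) atTop (𝓝 (V t))) {t : ℝ} (ht : t ∈ Ioo 0 T)
    {v : H} (hv : HasDerivAt V v t) : f t - v - F (V t) ∈ A (V t) := by
  have htI : t ∈ Icc 0 T := Ioo_subset_Icc_self ht
  refine hA.mem_of_forall_inner_nonneg fun y η hη => ?_
  set ψ : ℝ × H → ℝ := fun p => inner ℝ (f p.1 - F p.2 - η) (p.2 - y) with hψ
  have hψc : Continuous ψ := by fun_prop
  suffices h : inner ℝ (V t - y) v ≤ ψ (t, V t) by
    simp only [hψ] at h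
    rw [real_inner_comm] at h
    rw [show f t - v - F (V t) - η = (f t - F (V t) - η) - v by abel, inner_sub_left]
    linarith
  refine le_of_forall_pos_le_add fun ε hε => ?_
  obtain ⟨δ, hδ, hball⟩ := Metric.continuousAt_iff.1 (hψc.continuousAt (x := (t, V t))) (ε / 2)
    (half_pos hε)
  have hderiv : HasDerivWithinAt (fun s => ‖V s - y‖ ^ 2) (2 * inner ℝ (V t - y) v) (Ioi t) t :=
    (hv.sub_const y).hasDerivWithinAt.norm_sq
  rw [hasDerivWithinAt_iff_tendsto_slope' self_notMem_Ioi] at hderiv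
  -- Derivatives of `u n` need not converge, but increments of `‖u n - y‖ ^ 2` do. They are bounded
  -- on short intervals uniformly in large `n`, and only afterwards is the slope sent to its limit.
  suffices h2 : ∀ᶠ τ in 𝓝[>] t, slope (fun s => ‖V s - y‖ ^ 2) t τ ≤ 2 * (ψ (t, V t) + ε) by
    have := le_of_tendsto hderiv h2
    linarith
  have hρ : 0 < min (T - t) (δ / (2 * (M + 1))) := lt_min (by linarith [ht.2]) (by positivity)
  filter_upwards [Ioo_mem_nhdsGT (lt_add_of_pos_right t hρ)] with τ hτ
  have hτT : τ ≤ T := by linarith [hτ.2, min_le_left (T - t) (δ / (2 * (M + 1)))]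
  have hτδ : (M + 1) * (τ - t) ≤ δ / 2 := by
    have : τ - t ≤ δ / (2 * (M + 1)) := by linarith [hτ.2, min_le_right (T - t) (δ / (2 * (M + 1)))]
    rw [le_div_iff₀ (by positivity)] at this
    linarith
  have hτI : Icc t τ ⊆ Icc 0 T := Icc_subset_Icc ht.1.le hτT
  have hτ0 : 0 < τ - t := sub_pos.2 hτ.1
  have key : ∀ᶠ n in atTop,
      ‖u n τ - y‖ ^ 2 - ‖u n t - y‖ ^ 2 ≤ 2 * (ψ (t, V t) + ε) * (τ - t) := by
    have h1 : ∀ᶠ n in atTop, ‖u n t - V t‖ < δ / 2 := by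
      have := (tendsto_iff_norm_sub_tendsto_zero.1 (hV t htI)).eventually_lt_const (half_pos hδ)
      exact this
    have h2 : ∀ᶠ n in atTop, c n * (2 * (M * ‖η‖)) < ε := by
      have h3 := hc_lim.mul_const (2 * (M * ‖η‖))
      rw [zero_mul] at h3
      exact h3.eventually_lt_const hε
    filter_upwards [h1, h2] with n hn1 hn2
    refine sub_le_mul_of_right_deriv_le hτ.1.le (φ := fun s => ‖u n s - y‖ ^ 2)
      (φ' := fun s => 2 * inner ℝ (u n s - y)
        (f s - F (u n s) - yosidaMap A (c n) (u n s))) ?_ ?_ ?_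
    · exact ContinuousOn.pow (ContinuousOn.norm (ContinuousOn.sub
        (fun s hs => ((hu n s (hτI hs)).continuousWithinAt).mono hτI) continuousOn_const)) 2
    · intro s hs
      have h4 : HasDerivWithinAt (u n) _ (Ici s) s :=
        (hu n s (hτI ⟨hs.1, hs.2.le⟩)).mono_of_mem_nhdsWithin (Icc_mem_nhdsGE_of_mem ⟨ht.1.le.trans hs.1, hs.2.trans_le hτT⟩)
      exact (h4.sub_const y).norm_sq
    · intro s hs
      have hsI := hτI ⟨hs.1, hs.2.le⟩
      have h4 := two_mul_inner_yosida_le hA (g := f s - F (u n s)) hη (hc n) (hyM n s hsI)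
      have h5 : ‖u n s - u n t‖ ≤ M * (s - t) := by
        have := (convex_Icc 0 T).norm_image_sub_le_of_norm_hasDerivWithin_le (hu n) (huM n) htI hsI
        rwa [Real.norm_of_nonneg (sub_nonneg.2 hs.1)] at this
      have h6 : M * (s - t) ≤ M * (τ - t) :=
        mul_le_mul_of_nonneg_left (by linarith [hs.2]) hM
      have h7 : ψ (s, u n s) < ψ (t, V t) + ε / 2 := by
        have h8 : dist (s, u n s) (t, V t) < δ := by
          rw [Prod.dist_eq, max_lt_iff]
          constructor
          · rw [Real.dist_eq, abs_of_nonneg (sub_nonneg.2 hs.1)]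
            nlinarith [hs.2]
          · rw [dist_eq_norm, ← sub_add_sub_cancel _ (u n t)]
            refine (norm_add_le _ _).trans_lt ?_
            nlinarith
        have h9 := hball h8
        rw [Real.dist_eq] at h9
        linarith [(abs_lt.1 h9).2]
      simp only [hψ] at h7
      linarith
  have hlim : ‖V τ - y‖ ^ 2 - ‖V t - y‖ ^ 2 ≤ 2 * (ψ (t, V t) + ε) * (τ - t) :=
    le_of_tendsto ((((hV τ (hτI (right_mem_Icc.2 hτ.1.le))).sub_const y).norm.pow 2).sub
      (((hV t htI).sub_const y).norm.pow 2)) key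
  rw [slope_def_field, div_le_iff₀ hτ0]
  exact hlim

/-- Existence of strong solutions for a globally Lipschitz perturbation and regular data. -/
theorem exists_isStrongSolution {A : H → Set H} (hA : IsMaximalMonotoneOperator A) {F : H → H}
    {L : ℝ} (hL : 0 ≤ L) (hF : ∀ x y, ‖F x - F y‖ ≤ L * ‖x - y‖) {f : ℝ → H} {K : ℝ}
    (hK : 0 ≤ K) (hf : ∀ s t, ‖f s - f t‖ ≤ K * |s - t|) {T : ℝ} (hT : 0 ≤ T) {u₀ : H}
    (hu₀ : u₀ ∈ operatorDomain A) :
    ∃ u : ℝ → H, u 0 = u₀ ∧ IsStrongSolution A F f T u := by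
  obtain ⟨M, hM, hex⟩ := exists_solution_yosida hA hL hF hK hf hT hu₀
  have hne : ∃ x, (A x).Nonempty := ⟨u₀, hu₀⟩
  set c : ℕ → ℝ := fun n => 1 / ((n : ℝ) + 1)
  have hc : ∀ n, 0 < c n := fun n => Nat.one_div_pos_of_nat
  have hc_lim : Tendsto c atTop (𝓝 0) := tendsto_one_div_add_atTop_nhds_zero_nat
  choose u hu0 hu using fun n => hex (c n) (hc n)
  have hk : 2 * L + 1 ≠ 0 := by positivity
  have hlim : ∀ t ∈ Icc 0 T, ∃ x, Tendsto (fun n => u n t) atTop (𝓝 x) := by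
    intro t ht
    set B := 4 * M ^ 2 / (2 * L + 1) * (Real.exp ((2 * L + 1) * t) - 1) with hB
    have hest : ∀ m n, ‖u m t - u n t‖ ^ 2 ≤ (c m + c n) * B := by
      intro m n
      refine (norm_sq_sub_le_of_yosida hA hne hF (hc m) (hc n) ((hu0 m).trans (hu0 n).symm)
        (fun t ht => (hu m t ht).1) (fun t ht => (hu n t ht).1) (fun t ht => (hu m t ht).2.2)
        (fun t ht => (hu n t ht).2.2) t ht).trans_eq ?_
      rw [gronwallBound_of_K_ne_0 hk, hB]
      ring
    refine cauchySeq_tendsto_of_complete (Metric.cauchySeq_iff'.2 fun ε hε => ?_)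
    have h1 : ∀ᶠ n in atTop, 2 * c n * |B| < ε ^ 2 := by
      have h2 := (hc_lim.const_mul 2).mul_const |B|
      rw [mul_zero, zero_mul] at h2
      exact h2.eventually_lt_const (by positivity)
    obtain ⟨N, hN⟩ := h1.exists
    refine ⟨N, fun n hn => ?_⟩
    rw [dist_eq_norm]
    refine lt_of_pow_lt_pow_left₀ 2 hε.le ((hest n N).trans_lt (lt_of_le_of_lt ?_ hN))
    have h3 : c n ≤ c N := Nat.one_div_le_one_div hn
    have h4 : 0 ≤ c n + c N := add_nonneg (hc n).le (hc N).le
    calc (c n + c N) * B ≤ (c n + c N) * |B| := mul_le_mul_of_nonneg_left (le_abs_self B) h4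
      _ ≤ 2 * c N * |B| := mul_le_mul_of_nonneg_right (by linarith) (abs_nonneg B)
  choose! g hg using hlim
  -- Constant extension outside `[0,T]` makes the limit Lipschitz on all of `ℝ`, as the
  -- differentiability theorem requires.
  set V : ℝ → H := fun t => g (projIcc 0 T hT t) with hVdef
  have hV : ∀ t ∈ Icc 0 T, Tendsto (fun n => u n t) atTop (𝓝 (V t)) := fun t ht => by
    simp only [hVdef, projIcc_of_mem hT ht]
    exact hg t ht
  have hgLip : ∀ s ∈ Icc 0 T, ∀ t ∈ Icc 0 T, ‖g s - g t‖ ≤ M * |s - t| := fun s hs t ht =>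
    le_of_tendsto ((hg s hs).sub (hg t ht)).norm (Eventually.of_forall fun n =>
      (convex_Icc 0 T).norm_image_sub_le_of_norm_hasDerivWithin_le (fun r hr => (hu n r hr).1)
        (fun r hr => (hu n r hr).2.1) ht hs)
  have hVLip : LipschitzWith M.toNNReal V := LipschitzWith.of_dist_le_mul fun s t => by
    rw [Real.coe_toNNReal _ hM, dist_eq_norm]
    refine (hgLip _ (projIcc 0 T hT s).2 _ (projIcc 0 T hT t).2).trans
      (mul_le_mul_of_nonneg_left ?_ hM)
    have := (LipschitzWith.projIcc hT).dist_le_mul s t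
    rwa [NNReal.coe_one, one_mul, Subtype.dist_eq, Real.dist_eq] at this
  have hFc : Continuous F := (LipschitzWith.of_dist_le_mul (K := L.toNNReal) fun s t => by
    rw [Real.coe_toNNReal _ hL, dist_eq_norm, dist_eq_norm]; exact hF s t).continuous
  have hfc : Continuous f := (LipschitzWith.of_dist_le_mul (K := K.toNNReal) fun s t => by
    rw [Real.coe_toNNReal _ hK, dist_eq_norm, Real.dist_eq]; exact hf s t).continuous
  refine ⟨V, tendsto_nhds_unique (hV 0 (left_mem_Icc.2 hT)) (by simp [hu0]),
    ⟨_, hVLip.lipschitzOnWith⟩, fun t ht => ?_, ?_⟩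
  · have h1 : Tendsto (fun n => resolventMap A (c n) (u n t)) atTop (𝓝 (V t)) := by
      have h2 : Tendsto (fun n => c n • yosidaMap A (c n) (u n t)) atTop (𝓝 0) := by
        have h3 := hc_lim.mul_const M
        rw [zero_mul] at h3
        refine squeeze_zero_norm (fun n => ?_) h3
        rw [norm_smul, Real.norm_of_nonneg (hc n).le]
        exact mul_le_mul_of_nonneg_left (hu n t ht).2.2 (hc n).le
      have h4 := (hV t ht).sub h2
      rw [sub_zero] at h4
      exact h4.congr fun n => (resolventMap_eq_sub (hc n) _).symm
    exact hA.mem_domain_of_tendsto (fun n => hA.yosidaMap_mem hne (hc n) _)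
      (fun n => (hu n t ht).2.2) h1
  · filter_upwards [hVLip.ae_exists_hasDerivAt 0 T] with t ht htI
    obtain ⟨v, hv⟩ := ht htI
    exact ⟨v, hv, hA.mem_of_yosida_limit hFc hfc hM hc hc_lim (fun n t ht => (hu n t ht).1)
      (fun n t ht => (hu n t ht).2.1) (fun n t ht => (hu n t ht).2.2) hV htI hv⟩

end StrongExistence

/-! ### L¹ stability estimates -/

section Stability

theorem le_mul_exp_of_le_add_mul_integral {N : ℝ → ℝ} {a L T : ℝ} (hL : 0 ≤ L)
    (hN : Continuous N) (h : ∀ t ∈ Icc 0 T, N t ≤ a + L * ∫ s in (0 : ℝ)..t, N s) :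
    ∀ t ∈ Icc 0 T, N t ≤ a * Real.exp (L * t) := by
  have hder : ∀ t, HasDerivAt (fun t => a + L * ∫ s in (0 : ℝ)..t, N s) (L * N t) t := fun t =>
    ((intervalIntegral.integral_hasDerivAt_right (hN.intervalIntegrable 0 t)
      hN.aestronglyMeasurable.stronglyMeasurableAtFilter hN.continuousAt).const_mul L).const_add a
  intro t ht
  refine (h t ht).trans ?_
  have := le_gronwallBound_of_liminf_deriv_right_le (K := L) (ε := 0) (δ := a) (a := 0) (b := T)
    (f := fun t => a + L * ∫ s in (0 : ℝ)..t, N s)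
    (fun s _ => (hder s).continuousAt.continuousWithinAt)
    (fun s _ r hr => (hder s).hasDerivWithinAt.liminf_right_slope_le hr) (by simp)
    (fun s hs => by
      rw [add_zero]
      exact mul_le_mul_of_nonneg_left (h s ⟨hs.1, hs.2.le⟩) hL) t ht
  rwa [gronwallBound_ε0, sub_zero] at this

variable {H : Type*} [NormedAddCommGroup H] [InnerProductSpace ℝ H]

/-- Working with the norm rather than its square is what leads to an `L¹` estimate. Where the norm
vanishes it has a minimum and zero derivative; elsewhere the derivative of the square is divided by
the norm. -/
theorem IsMonotoneOperator.deriv_norm_sub_le {A : H → Set H} (hA : IsMonotoneOperator A)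
    {F : H → H} {L : ℝ} (hL : 0 ≤ L) (hF : ∀ x y, ‖F x - F y‖ ≤ L * ‖x - y‖) {u v : ℝ → H}
    {f g a b : H} {t : ℝ} (hu : HasDerivAt u a t) (hv : HasDerivAt v b t)
    (huA : f - a - F (u t) ∈ A (u t)) (hvA : g - b - F (v t) ∈ A (v t))
    (hd : DifferentiableAt ℝ (fun s => ‖u s - v s‖) t) :
    deriv (fun s => ‖u s - v s‖) t ≤ ‖f - g‖ + L * ‖u t - v t‖ := by
  rcases (norm_nonneg (u t - v t)).eq_or_lt with h0 | h0
  · have hmin : IsLocalMin (fun s => ‖u s - v s‖) t :=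
      Eventually.of_forall fun s => by
        dsimp only
        rw [← h0]
        exact norm_nonneg _
    rw [hmin.deriv_eq_zero]
    positivity
  · have h1 := hd.hasDerivAt.pow 2
    have h2 := h1.unique ((hu.sub hv).norm_sq)
    simp only [Nat.cast_ofNat, Nat.add_one_sub_one, pow_one, Pi.sub_apply] at h2
    have h3 := hA _ _ _ huA _ hvA
    have h4 := real_inner_le_norm (f - g) (u t - v t)
    have h5 := (abs_le.1 (abs_real_inner_le_norm (F (u t) - F (v t)) (u t - v t))).1
    have h6 := mul_le_mul_of_nonneg_right (hF (u t) (v t)) (norm_nonneg (u t - v t))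
    rw [show f - a - F (u t) - (g - b - F (v t)) = (f - g) - (F (u t) - F (v t)) - (a - b) by abel,
      inner_sub_left, inner_sub_left] at h3
    rw [real_inner_comm] at h2
    refine le_of_mul_le_mul_left ?_ h0
    nlinarith

/-- The distance of two Lipschitz functions is absolutely continuous, so the a.e. bound on its
derivative can be integrated and fed into Gronwall. -/
theorem IsStrongSolution.norm_sub_le {A : H → Set H} (hA : IsMonotoneOperator A) {F : H → H}
    {L : ℝ} (hL : 0 ≤ L) (hF : ∀ x y, ‖F x - F y‖ ≤ L * ‖x - y‖) {f g u v : ℝ → H} {T : ℝ}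
    (hT : 0 ≤ T) (hf : IntegrableOn f (Icc 0 T)) (hg : IntegrableOn g (Icc 0 T))
    (hu : IsStrongSolution A F f T u) (hv : IsStrongSolution A F g T v) :
    ∀ t ∈ Icc 0 T, ‖u t - v t‖ ≤
      (‖u 0 - v 0‖ + ∫ s in Icc 0 T, ‖f s - g s‖) * Real.exp (L * T) := by
  set N : ℝ → ℝ := fun s => ‖u s - v s‖ with hN
  obtain ⟨K₁, hK₁⟩ := hu.lipschitz
  obtain ⟨K₂, hK₂⟩ := hv.lipschitz
  have hNLip : LipschitzOnWith (1 * (K₁ + K₂)) N (Icc 0 T) :=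
    lipschitzWith_one_norm.comp_lipschitzOnWith (hK₁.sub hK₂)
  have hNc : ContinuousOn N (Icc 0 T) := hNLip.continuousOn
  have hfg : IntegrableOn (fun s => ‖f s - g s‖) (Icc 0 T) := (hf.sub hg).norm
  set a := N 0 + ∫ s in Icc 0 T, ‖f s - g s‖ with ha
  have hint : ∀ t ∈ Icc 0 T, N t ≤ a + L * ∫ s in (0 : ℝ)..t, N s := by
    intro t ht
    have hsub : Icc 0 t ⊆ Icc 0 T := Icc_subset_Icc_right ht.2
    have hAC : AbsolutelyContinuousOnInterval N 0 t :=
      LipschitzOnWith.absolutelyContinuousOnInterval (by rw [uIcc_of_le ht.1]; exact hNLip.mono hsub)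
    have hfgI : IntervalIntegrable (fun s => ‖f s - g s‖) volume 0 t :=
      (intervalIntegrable_iff_integrableOn_Icc_of_le ht.1).2 (hfg.mono_set hsub)
    have hNI : IntervalIntegrable N volume 0 t :=
      ContinuousOn.intervalIntegrable (by rw [uIcc_of_le ht.1]; exact hNc.mono hsub)
    have h1 : ∫ s in (0 : ℝ)..t, deriv N s ≤ ∫ s in (0 : ℝ)..t, (‖f s - g s‖ + L * N s) := by
      refine intervalIntegral.integral_mono_ae_restrict ht.1 hAC.intervalIntegrable_deriv
        (hfgI.add (hNI.const_mul L)) ?_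
      rw [EventuallyLE, ← restrict_Ioo_eq_restrict_Icc, ae_restrict_iff' measurableSet_Ioo]
      filter_upwards [hAC.ae_differentiableAt, hu.inclusion, hv.inclusion] with s hs hus hvs hmem
      have hmemT : s ∈ Ioo 0 T := ⟨hmem.1, hmem.2.trans_le ht.2⟩
      obtain ⟨x, hx, hxA⟩ := hus hmemT
      obtain ⟨y, hy, hyA⟩ := hvs hmemT
      exact hA.deriv_norm_sub_le hL hF hx hy hxA hyA
        (hs (by rw [uIcc_of_le ht.1]; exact Ioo_subset_Icc_self hmem))
    rw [hAC.integral_deriv_eq_sub, intervalIntegral.integral_add hfgI (hNI.const_mul L),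
      intervalIntegral.integral_const_mul, intervalIntegral.integral_of_le ht.1,
      ← integral_Icc_eq_integral_Ioc] at h1
    have h2 : ∫ s in Icc 0 t, ‖f s - g s‖ ≤ ∫ s in Icc 0 T, ‖f s - g s‖ :=
      setIntegral_mono_set hfg (Eventually.of_forall fun _ => norm_nonneg _) hsub.eventuallyLE
    linarith
  have hproj : ∀ t ∈ Icc 0 T, N (projIcc 0 T hT t) = N t := fun t ht => by
    rw [projIcc_of_mem hT ht]
  have ha0 : 0 ≤ a := add_nonneg (norm_nonneg _) (integral_nonneg fun _ => norm_nonneg _)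
  intro t ht
  have h3 := le_mul_exp_of_le_add_mul_integral (N := fun t => N (projIcc 0 T hT t))
    (T := T) (a := a) hL (hNc.comp_continuous
      (continuous_subtype_val.comp continuous_projIcc) fun t => (projIcc 0 T hT t).2) (fun t ht => by
      rw [hproj t ht, intervalIntegral.integral_congr (g := N) fun s hs => hproj s (by
        rw [uIcc_of_le ht.1] at hs
        exact ⟨hs.1, hs.2.trans ht.2⟩)]
      exact hint t ht) t ht
  rw [hproj t ht] at h3
  exact h3.trans (mul_le_mul_of_nonneg_left (Real.exp_le_exp.2
    (mul_le_mul_of_nonneg_left ht.2 hL)) ha0)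

theorem integral_norm_sub_le_add {X : Type*} [MeasurableSpace X] {μ : Measure X} {E : Type*}
    [NormedAddCommGroup E] {a b c : X → E} (ha : Integrable a μ) (hb : Integrable b μ)
    (hc : Integrable c μ) :
    ∫ x, ‖a x - c x‖ ∂μ ≤ ∫ x, ‖a x - b x‖ ∂μ + ∫ x, ‖b x - c x‖ ∂μ := by
  have h1 : Integrable (fun x => ‖a x - b x‖) μ := (ha.sub hb).norm
  have h2 : Integrable (fun x => ‖b x - c x‖) μ := (hb.sub hc).norm
  rw [← integral_add h1 h2]
  exact integral_mono (ha.sub hc).norm (h1.add h2)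
    fun x => norm_sub_le_norm_sub_add_norm_sub _ _ _

theorem IsGeneralizedSolution.norm_sub_le {A : H → Set H} (hA : IsMonotoneOperator A) {F : H → H}
    {L : ℝ} (hL : 0 ≤ L) (hF : ∀ x y, ‖F x - F y‖ ≤ L * ‖x - y‖) {h k U V : ℝ → H} {T : ℝ}
    (hT : 0 ≤ T) (hh : IntegrableOn h (Icc 0 T)) (hk : IntegrableOn k (Icc 0 T))
    (hU : IsGeneralizedSolution A F h T U) (hV : IsGeneralizedSolution A F k T V) :
    ∀ t ∈ Icc 0 T, ‖U t - V t‖ ≤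
      (‖U 0 - V 0‖ + ∫ s in Icc 0 T, ‖h s - k s‖) * Real.exp (L * T) := by
  obtain ⟨-, f, u, hf, hu, hfh, huU⟩ := hU
  obtain ⟨-, g, v, hg, hv, hgk, hvV⟩ := hV
  intro t ht
  have h0 : (0 : ℝ) ∈ Icc 0 T := left_mem_Icc.2 hT
  have hlim := (((((huU.tendsto_at h0).sub (hvV.tendsto_at h0)).norm.add
    ((hfh.add_const (∫ s in Icc 0 T, ‖h s - k s‖)).add hgk))).mul_const (Real.exp (L * T)))
  rw [zero_add, add_zero] at hlim
  refine le_of_tendsto_of_tendsto' ((huU.tendsto_at ht).sub (hvV.tendsto_at ht)).norm hlim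
    fun n => ?_
  refine ((hu n).norm_sub_le hA hL hF hT (hf n) (hg n) (hv n) t ht).trans ?_
  gcongr
  have h1 := integral_norm_sub_le_add (hf n) hh (hg n)
  have h2 := integral_norm_sub_le_add hh hk (hg n)
  simp only [norm_sub_rev (k _) (g n _)] at h2
  linarith

end Stability

/-! ### Generalized solutions for globally Lipschitz perturbations -/

section GeneralizedExistence

/-- Approximation in two stages, by a continuous and then by a smooth function, followed by clamping
the time variable to get a global Lipschitz constant. -/
theorem exists_lipschitz_integral_norm_sub_le {E : Type*} [NormedAddCommGroup E]
    [NormedSpace ℝ E] [CompleteSpace E] {h : ℝ → E} {T ε : ℝ} (hT : 0 ≤ T)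
    (hh : IntegrableOn h (Icc 0 T)) (hε : 0 < ε) :
    ∃ (f : ℝ → E) (K : ℝ), 0 ≤ K ∧ (∀ s t, ‖f s - f t‖ ≤ K * |s - t|) ∧
      ∫ t in Icc 0 T, ‖f t - h t‖ ≤ ε := by
  obtain ⟨g, hg, hgi⟩ := hh.exists_boundedContinuous_integral_sub_le (half_pos hε)
  have hpu : UniformContinuous fun t => g (projIcc 0 T hT t) :=
    (CompactSpace.uniformContinuous_of_continuous
      (g.continuous.comp continuous_subtype_val)).comp (LipschitzWith.projIcc hT).uniformContinuous
  obtain ⟨p, hp, hpg⟩ := hpu.exists_contDiff_dist_le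
    (show 0 < ε / (2 * (T + 1)) by positivity)
  obtain ⟨K, hK⟩ := (hp.contDiffOn (s := Icc 0 T)).exists_lipschitzOnWith (by simp)
    (convex_Icc 0 T) isCompact_Icc
  refine ⟨fun t => p (projIcc 0 T hT t), K, K.2, fun s t => ?_, ?_⟩
  · have h1 := hK.norm_sub_le (projIcc 0 T hT s).2 (projIcc 0 T hT t).2
    refine h1.trans (mul_le_mul_of_nonneg_left ?_ K.2)
    have := (LipschitzWith.projIcc hT).dist_le_mul s t
    rwa [NNReal.coe_one, one_mul, Subtype.dist_eq, Real.dist_eq] at this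
  · have hpi : IntegrableOn (fun t => p (projIcc 0 T hT t)) (Icc 0 T) :=
      (hp.continuous.comp (continuous_subtype_val.comp
        continuous_projIcc)).continuousOn.integrableOn_Icc
    have h1 := integral_norm_sub_le_add hpi hgi hh
    simp only [norm_sub_rev (g _)] at h1
    have h2 : ∫ t in Icc 0 T, ‖p (projIcc 0 T hT t) - g t‖ ≤ ε / 2 := by
      have h3 : ∫ t in Icc 0 T, ‖p (projIcc 0 T hT t) - g t‖ ≤
          ∫ t in Icc 0 T, ε / (2 * (T + 1)) := by
        refine setIntegral_mono_on (hpi.sub hgi).norm (integrableOn_const (by simp))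
          measurableSet_Icc fun t ht => ?_
        have := (hpg t).le
        rw [dist_eq_norm] at this
        rwa [projIcc_of_mem hT ht] at this ⊢
      refine h3.trans ?_
      rw [setIntegral_const, measureReal_def, Real.volume_Icc, sub_zero, ENNReal.toReal_ofReal hT,
        smul_eq_mul, mul_div_assoc', div_le_div_iff₀ (by positivity) two_pos]
      nlinarith
    linarith

variable {H : Type*} [NormedAddCommGroup H] [InnerProductSpace ℝ H] [CompleteSpace H]

/-- Existence of generalized solutions for a globally Lipschitz perturbation. -/
theorem exists_isGeneralizedSolution {A : H → Set H} (hA : IsMaximalMonotoneOperator A)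
    {F : H → H} {L : ℝ} (hL : 0 ≤ L) (hF : ∀ x y, ‖F x - F y‖ ≤ L * ‖x - y‖) {h : ℝ → H} {T : ℝ}
    (hT : 0 ≤ T) (hh : IntegrableOn h (Icc 0 T)) {U₀ : H}
    (hU₀ : U₀ ∈ closure (operatorDomain A)) :
    ∃ U : ℝ → H, U 0 = U₀ ∧ IsGeneralizedSolution A F h T U := by
  set c : ℕ → ℝ := fun n => 1 / ((n : ℝ) + 1)
  have hc : ∀ n, 0 < c n := fun n => Nat.one_div_pos_of_nat
  have hc_lim : Tendsto c atTop (𝓝 0) := tendsto_one_div_add_atTop_nhds_zero_nat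
  choose x hxA hx using fun n => Metric.mem_closure_iff.1 hU₀ (c n) (hc n)
  choose f K hK hfK hf using fun n => exists_lipschitz_integral_norm_sub_le hT hh (hc n)
  have hfi : ∀ n, IntegrableOn (f n) (Icc 0 T) := fun n =>
    (LipschitzWith.of_dist_le_mul (K := (K n).toNNReal) fun s t => by
      rw [Real.coe_toNNReal _ (hK n), dist_eq_norm, Real.dist_eq]
      exact hfK n s t).continuous.continuousOn.integrableOn_Icc
  choose u hu0 hu using fun n => exists_isStrongSolution hA hL hF (hK n) (hfK n) hT (hxA n)
  have hest : ∀ m n, ∀ t ∈ Icc 0 T,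
      ‖u m t - u n t‖ ≤ 2 * (c m + c n) * Real.exp (L * T) := by
    intro m n t ht
    refine ((hu m).norm_sub_le hA.1 hL hF hT (hfi m) (hfi n) (hu n) t ht).trans ?_
    gcongr
    have h1 := integral_norm_sub_le_add (hfi m) hh (hfi n)
    simp only [norm_sub_rev (h _)] at h1
    have h2 := dist_triangle_left (x m) (x n) U₀
    rw [dist_eq_norm (x m)] at h2
    rw [hu0, hu0]
    linarith [hx m, hx n, hf m, hf n]
  have hcauchy : UniformCauchySeqOn u atTop (Icc 0 T) := by
    rw [Metric.uniformCauchySeqOn_iff]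
    intro ε hε
    have h1 : ∀ᶠ n in atTop, 4 * c n * Real.exp (L * T) < ε := by
      have h2 := (hc_lim.const_mul 4).mul_const (Real.exp (L * T))
      rw [mul_zero, zero_mul] at h2
      exact h2.eventually_lt_const hε
    obtain ⟨N, hN⟩ := h1.exists
    refine ⟨N, fun m hm n hn t ht => ?_⟩
    rw [dist_eq_norm]
    refine ((hest m n t ht).trans ?_).trans_lt hN
    have h3 : c m ≤ c N := Nat.one_div_le_one_div hm
    have h4 : c n ≤ c N := Nat.one_div_le_one_div hn
    have h5 := Real.exp_nonneg (L * T)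
    nlinarith
  have hlim : ∀ t ∈ Icc 0 T, ∃ y, Tendsto (fun n => u n t) atTop (𝓝 y) := fun t ht =>
    cauchySeq_tendsto_of_complete (hcauchy.cauchySeq ht)
  choose! U hU using hlim
  have hunif : TendstoUniformlyOn u U atTop (Icc 0 T) :=
    hcauchy.tendstoUniformlyOn_of_tendsto hU
  refine ⟨U, ?_, ?_, f, u, hfi, hu, ?_, hunif⟩
  · refine tendsto_nhds_unique (hU 0 (left_mem_Icc.2 hT)) ?_
    simp only [hu0]
    rw [tendsto_iff_dist_tendsto_zero]
    refine squeeze_zero (fun _ => dist_nonneg) (fun n => ?_) hc_lim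
    rw [dist_comm]
    exact (hx n).le
  · refine hunif.continuousOn (Eventually.of_forall fun n => ?_).frequently
    obtain ⟨K, hK⟩ := (hu n).lipschitz
    exact hK.continuousOn
  · exact squeeze_zero (fun n => integral_nonneg fun _ => norm_nonneg _) hf hc_lim

end GeneralizedExistence

/-! ### Restriction and change of perturbation -/

section Transfer

variable {H : Type*} [NormedAddCommGroup H] [InnerProductSpace ℝ H] {A : H → Set H} {F : H → H}
  {h U : ℝ → H} {T : ℝ}

theorem IsStrongSolution.mono (hU : IsStrongSolution A F h T U) {S : ℝ} (hST : S ≤ T) :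
    IsStrongSolution A F h S U where
  lipschitz := hU.lipschitz.imp fun _ hK => hK.mono (Icc_subset_Icc_right hST)
  mem_domain t ht := hU.mem_domain t (Icc_subset_Icc_right hST ht)
  inclusion := by
    filter_upwards [hU.inclusion] with t ht hmem
    exact ht ⟨hmem.1, hmem.2.trans_le hST⟩

/-- Integrability of `h` is needed to compare the two integrals: a non-integrable `‖f n - h‖` would
have integral `0` on the larger interval. -/
theorem IsGeneralizedSolution.mono (hh : IntegrableOn h (Icc 0 T))
    (hU : IsGeneralizedSolution A F h T U) {S : ℝ} (hST : S ≤ T) :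
    IsGeneralizedSolution A F h S U := by
  have hsub : Icc 0 S ⊆ Icc 0 T := Icc_subset_Icc_right hST
  obtain ⟨hc, f, u, hf, hu, hfh, huU⟩ := hU
  refine ⟨hc.mono hsub, f, u, fun n => (hf n).mono_set hsub, fun n => (hu n).mono hST, ?_,
    huU.mono hsub⟩
  exact squeeze_zero (fun n => integral_nonneg fun _ => norm_nonneg _) (fun n =>
    setIntegral_mono_set ((hf n).sub hh).norm (Eventually.of_forall fun _ => norm_nonneg _)
      hsub.eventuallyLE) hfh

theorem IsGeneralizedSolution.congr (hU : IsGeneralizedSolution A F h T U) {V : ℝ → H}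
    (hUV : EqOn U V (Icc 0 T)) : IsGeneralizedSolution A F h T V := by
  obtain ⟨hc, f, u, hf, hu, hfh, huU⟩ := hU
  exact ⟨hc.congr hUV.symm, f, u, hf, hu, hfh, huU.congr_right hUV⟩

theorem IsGeneralizedSolution.apply_zero_mem_closure (hT : 0 ≤ T)
    (hU : IsGeneralizedSolution A F h T U) : U 0 ∈ closure (operatorDomain A) := by
  obtain ⟨-, f, u, -, hu, -, huU⟩ := hU
  exact mem_closure_of_tendsto (huU.tendsto_at (left_mem_Icc.2 hT))
    (Eventually.of_forall fun n => (hu n).mem_domain 0 (left_mem_Icc.2 hT))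

/-- The perturbation only matters on a ball that contains the solution in its interior. -/
theorem IsGeneralizedSolution.congr_perturbation (hU : IsGeneralizedSolution A F h T U)
    {G : H → H} {R : ℝ} (hFG : ∀ x, ‖x‖ ≤ R → F x = G x) (hUR : ∀ t ∈ Icc 0 T, ‖U t‖ < R) :
    IsGeneralizedSolution A G h T U := by
  obtain ⟨hc, f, u, hf, hu, hfh, huU⟩ := hU
  -- Compactness gives a uniform margin, so the approximating strong solutions lie in the ball from
  -- some index `N` on; the earlier ones are dropped.
  have hgap : ∃ δ > 0, ∀ t ∈ Icc 0 T, ‖U t‖ + δ ≤ R := by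
    rcases (Icc 0 T).eq_empty_or_nonempty with hemp | hne
    · exact ⟨1, one_pos, by simp [hemp]⟩
    · obtain ⟨s, hs, hmax⟩ := isCompact_Icc.exists_isMaxOn hne hc.norm
      refine ⟨R - ‖U s‖, sub_pos.2 (hUR s hs), fun t ht => ?_⟩
      have : ‖U t‖ ≤ ‖U s‖ := hmax ht
      linarith
  obtain ⟨δ, hδ, hδR⟩ := hgap
  obtain ⟨N, hN⟩ := eventually_atTop.1 (Metric.tendstoUniformlyOn_iff.1 huU δ hδ)
  have hshift : Tendsto (fun n => n + N) atTop atTop := tendsto_add_atTop_nat N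
  refine ⟨hc, fun n => f (n + N), fun n => u (n + N), fun n => hf _, fun n => ?_,
    hfh.comp hshift, fun W hW => hshift.eventually (huU W hW)⟩
  refine ⟨(hu _).lipschitz, (hu _).mem_domain, ?_⟩
  filter_upwards [(hu (n + N)).inclusion] with t ht hmem
  have hle : ‖u (n + N) t‖ ≤ R := by
    have htI := Ioo_subset_Icc_self hmem
    have h1 := hN (n + N) (Nat.le_add_left _ _) t htI
    rw [dist_eq_norm, norm_sub_rev] at h1
    have h2 := norm_sub_norm_le (u (n + N) t) (U t)
    linarith [hδR t htI]
  rw [← hFG _ hle]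
  exact ht hmem

end Transfer

/-! ### Locally Lipschitz perturbations and maximal solutions -/

section LocallyLipschitzPerturbation

theorem exists_norm_lt_of_continuousOn_Icc {E : Type*} [NormedAddCommGroup E] {U : ℝ → E} {T : ℝ} (hU : ContinuousOn U (Icc 0 T)) :
    ∃ R, 0 < R ∧ ∀ t ∈ Icc 0 T, ‖U t‖ < R := by
  obtain ⟨C, hC⟩ := isCompact_Icc.exists_bound_of_continuousOn hU
  exact ⟨|C| + 1, by positivity, fun t ht => by linarith [hC t ht, le_abs_self C]⟩

variable {H : Type*} [NormedAddCommGroup H] [InnerProductSpace ℝ H] {A : H → Set H} {F : H → H}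

theorem IsLocallyLipschitzMap.exists_lipschitz_ballRetraction (hF : IsLocallyLipschitzMap F)
    {R : ℝ} (hR : 0 < R) : ∃ L, 0 ≤ L ∧
      ∀ x y, ‖F (ballRetraction R x) - F (ballRetraction R y)‖ ≤ L * ‖x - y‖ := by
  obtain ⟨L, hL, hLF⟩ := hF R hR.le
  refine ⟨L * 2, by positivity, fun x y => ?_⟩
  rw [mul_assoc]
  exact (hLF _ _ (norm_ballRetraction_le hR x) (norm_ballRetraction_le hR y)).trans
    (mul_le_mul_of_nonneg_left (norm_ballRetraction_sub_le hR x y) hL)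

theorem IsGeneralizedSolution.truncate {h U : ℝ → H} {T R : ℝ} (hR : 0 < R)
    (hU : IsGeneralizedSolution A F h T U) (hUR : ∀ t ∈ Icc 0 T, ‖U t‖ < R) :
    IsGeneralizedSolution A (fun x => F (ballRetraction R x)) h T U :=
  hU.congr_perturbation (fun x hx => by rw [ballRetraction_of_norm_le hR hx]) hUR

theorem IsGeneralizedSolution.of_truncate {h U : ℝ → H} {T R : ℝ} (hR : 0 < R)
    (hU : IsGeneralizedSolution A (fun x => F (ballRetraction R x)) h T U)
    (hUR : ∀ t ∈ Icc 0 T, ‖U t‖ < R) : IsGeneralizedSolution A F h T U :=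
  hU.congr_perturbation (fun x hx => by rw [ballRetraction_of_norm_le hR hx]) hUR

theorem IsGeneralizedSolution.eqOn (hA : IsMonotoneOperator A) (hF : IsLocallyLipschitzMap F)
    {h U V : ℝ → H} {T : ℝ} (hT : 0 ≤ T) (hh : IntegrableOn h (Icc 0 T))
    (hU : IsGeneralizedSolution A F h T U) (hV : IsGeneralizedSolution A F h T V)
    (h0 : U 0 = V 0) : EqOn U V (Icc 0 T) := by
  obtain ⟨R₁, hR₁, hUR⟩ := exists_norm_lt_of_continuousOn_Icc hU.1
  obtain ⟨R₂, hR₂, hVR⟩ := exists_norm_lt_of_continuousOn_Icc hV.1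
  have hR : 0 < max R₁ R₂ := lt_max_of_lt_left hR₁
  obtain ⟨L, hL, hLF⟩ := hF.exists_lipschitz_ballRetraction hR
  intro t ht
  have := (hU.truncate hR fun t ht => lt_max_of_lt_left (hUR t ht)).norm_sub_le hA hL hLF hT hh hh
    (hV.truncate hR fun t ht => lt_max_of_lt_right (hVR t ht)) t ht
  simp only [h0, sub_self, norm_zero, integral_zero, add_zero, zero_mul] at this
  exact sub_eq_zero.1 (norm_le_zero_iff.1 this)

/-- A solution of the truncated problem solves the original one slightly beyond any interval on
which it stays inside the ball. -/
theorem IsGeneralizedSolution.exists_gt_of_truncate {h W : ℝ → H} {S T R : ℝ} (hR : 0 < R)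
    (hS : 0 ≤ S) (hST : S < T) (hh : IntegrableOn h (Icc 0 T))
    (hW : IsGeneralizedSolution A (fun x => F (ballRetraction R x)) h T W)
    (hWR : ∀ t ∈ Icc 0 S, ‖W t‖ < R) : ∃ S' > S, IsGeneralizedSolution A F h S' W := by
  have hcont : ContinuousWithinAt W (Ici S) S :=
    (hW.1 S ⟨hS, hST.le⟩).mono_of_mem_nhdsWithin (Icc_mem_nhdsGE_of_mem ⟨hS, hST⟩)
  have hev : ∀ᶠ t in 𝓝[≥] S, ‖W t‖ < R :=
    hcont.norm.eventually_lt_const (hWR S (right_mem_Icc.2 hS))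
  obtain ⟨r, hr, hrW⟩ := (mem_nhdsGE_iff_exists_Icc_subset).1 hev
  refine ⟨min r T, lt_min hr hST, (hW.mono hh (min_le_right _ _)).of_truncate hR fun t ht => ?_⟩
  rcases le_total t S with htS | htS
  · exact hWR t ⟨ht.1, htS⟩
  · exact hrW ⟨htS, ht.2.trans (min_le_left _ _)⟩

variable [CompleteSpace H]

theorem exists_isGeneralizedSolution_local (hA : IsMaximalMonotoneOperator A)
    (hF : IsLocallyLipschitzMap F) {h : ℝ → H} (hh : ∀ T, IntegrableOn h (Icc 0 T)) {U₀ : H}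
    (hU₀ : U₀ ∈ closure (operatorDomain A)) :
    ∃ S > 0, ∃ W : ℝ → H, W 0 = U₀ ∧ IsGeneralizedSolution A F h S W := by
  have hR : 0 < ‖U₀‖ + 1 := by positivity
  obtain ⟨L, hL, hLF⟩ := hF.exists_lipschitz_ballRetraction hR
  obtain ⟨W, hW0, hW⟩ := exists_isGeneralizedSolution hA hL hLF zero_le_one (hh 1) hU₀
  obtain ⟨S, hS, hSW⟩ := hW.exists_gt_of_truncate hR le_rfl one_pos (hh 1) fun t ht => by
    rw [Icc_self] at ht
    rw [ht, hW0]
    exact lt_add_one _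
  exact ⟨S, hS, W, hW0, hSW⟩

/-- No concatenation is needed: the truncated problem is solved afresh from time `0` on `[0, S +
1]`, agrees with `U` on `[0,S]` by stability, and remains in the ball a little longer by continuity.
-/
theorem IsGeneralizedSolution.exists_extension (hA : IsMaximalMonotoneOperator A)
    (hF : IsLocallyLipschitzMap F) {h U : ℝ → H} (hh : ∀ T, IntegrableOn h (Icc 0 T)) {S : ℝ}
    (hS : 0 ≤ S) (hU : IsGeneralizedSolution A F h S U) :
    ∃ S' > S, ∃ W : ℝ → H, W 0 = U 0 ∧ IsGeneralizedSolution A F h S' W := by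
  obtain ⟨R, hR, hUR⟩ := exists_norm_lt_of_continuousOn_Icc hU.1
  obtain ⟨L, hL, hLF⟩ := hF.exists_lipschitz_ballRetraction hR
  have hS1 : S < S + 1 := lt_add_one S
  obtain ⟨W, hW0, hW⟩ := exists_isGeneralizedSolution hA hL hLF (hS.trans hS1.le) (hh (S + 1))
    (hU.apply_zero_mem_closure hS)
  have hWU : ∀ t ∈ Icc 0 S, W t = U t := fun t ht => by
    have := (hW.mono (hh _) hS1.le).norm_sub_le hA.1 hL hLF hS (hh S) (hh S)
      (hU.truncate hR hUR) t ht
    simp only [hW0, sub_self, norm_zero, integral_zero, add_zero, zero_mul] at this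
    exact sub_eq_zero.1 (norm_le_zero_iff.1 this)
  obtain ⟨S', hS', hSW⟩ := hW.exists_gt_of_truncate hR hS hS1 (hh _) fun t ht => by
    rw [hWU t ht]
    exact hUR t ht
  exact ⟨S', hS', W, hW0, hSW⟩

/-- Continuous dependence on the data, on a closed interval. -/
theorem IsGeneralizedSolution.exists_tendstoUniformlyOn (hA : IsMaximalMonotoneOperator A)
    (hF : IsLocallyLipschitzMap F) {h U : ℝ → H} {T : ℝ} (hT : 0 ≤ T)
    (hh : IntegrableOn h (Icc 0 T)) (hU : IsGeneralizedSolution A F h T U) {V₀ : ℕ → H}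
    (hV₀ : ∀ n, V₀ n ∈ closure (operatorDomain A)) (hV₀_lim : Tendsto V₀ atTop (𝓝 (U 0)))
    {k : ℕ → ℝ → H} (hk : ∀ n, IntegrableOn (k n) (Icc 0 T))
    (hk_lim : Tendsto (fun n => ∫ t in Icc 0 T, ‖k n t - h t‖) atTop (𝓝 0)) :
    ∃ W : ℕ → ℝ → H, (∀ n, W n 0 = V₀ n) ∧ TendstoUniformlyOn W U atTop (Icc 0 T) ∧
      ∀ᶠ n in atTop, IsGeneralizedSolution A F (k n) T (W n) := by
  obtain ⟨R, hR, hUR⟩ := exists_norm_lt_of_continuousOn_Icc hU.1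
  -- The extra unit is room for the perturbed solutions: they enter the ball of radius `R + 1` once
  -- within distance `1` of `U`.
  have hR1 : 0 < R + 1 := by positivity
  obtain ⟨L, hL, hLF⟩ := hF.exists_lipschitz_ballRetraction hR1
  choose W hW0 hW using fun n => exists_isGeneralizedSolution hA hL hLF hT (hk n) (hV₀ n)
  have hest : ∀ n, ∀ t ∈ Icc 0 T, ‖W n t - U t‖ ≤
      (‖V₀ n - U 0‖ + ∫ s in Icc 0 T, ‖k n s - h s‖) * Real.exp (L * T) := fun n t ht => by
    rw [← hW0 n]
    exact (hW n).norm_sub_le hA.1 hL hLF hT (hk n) hh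
      (hU.truncate hR1 fun t ht => (hUR t ht).trans (lt_add_one R)) t ht
  have hlim : Tendsto (fun n => (‖V₀ n - U 0‖ + ∫ s in Icc 0 T, ‖k n s - h s‖) *
      Real.exp (L * T)) atTop (𝓝 0) := by
    simpa using ((tendsto_iff_norm_sub_tendsto_zero.1 hV₀_lim).add hk_lim).mul_const
      (Real.exp (L * T))
  refine ⟨W, hW0, Metric.tendstoUniformlyOn_iff.2 fun ε hε => ?_, ?_⟩
  · filter_upwards [hlim.eventually_lt_const hε] with n hn t ht
    rw [dist_comm, dist_eq_norm]
    exact (hest n t ht).trans_lt hn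
  · filter_upwards [hlim.eventually_lt_const one_pos] with n hn
    refine (hW n).of_truncate hR1 fun t ht => ?_
    have h1 := norm_sub_norm_le (W n t) (U t)
    linarith [hest n t ht, hUR t ht]

/-- A maximal solution extends every solution of the Cauchy problem on a closed interval. -/
theorem IsMaximalGeneralizedSolution.lt_and_eqOn (hA : IsMaximalMonotoneOperator A)
    (hF : IsLocallyLipschitzMap F) {h U W : ℝ → H} (hh : ∀ T, IntegrableOn h (Icc 0 T)) {U₀ : H}
    {T : EReal} (hU : IsMaximalGeneralizedSolution A F h U₀ T U) {S : ℝ} (hS : 0 < S)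
    (hW : IsGeneralizedSolution A F h S W) (hW0 : W 0 = U₀) :
    (S : EReal) < T ∧ EqOn W U (Icc 0 S) := by
  have hlt : (S : EReal) < T := by
    by_contra! hle
    obtain ⟨S', hS', V, hV0, hV⟩ := hW.exists_extension hA hF hh hS.le
    have hTS' : T < S' := hle.trans_lt (EReal.coe_lt_coe_iff.2 hS')
    refine hTS'.ne' (hU.2 S' V hTS'.le ⟨?_, hV0.trans hW0, fun s _ hs => ?_⟩ fun t ht0 htT => ?_)
    · exact EReal.coe_pos.2 (hS.trans hS')
    · exact hV.mono (hh _) (EReal.coe_lt_coe_iff.1 hs).le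
    · obtain ⟨r, htr, hrT⟩ := EReal.lt_iff_exists_real_btwn.1 htT
      have htr' := EReal.coe_lt_coe_iff.1 htr
      have hrS' := EReal.coe_lt_coe_iff.1 (hrT.trans hTS')
      exact (hV.mono (hh _) hrS'.le).eqOn hA.1 hF (ht0.trans htr'.le) (hh r)
        (hU.1.solution r (ht0.trans_lt htr') hrT) (by rw [hV0, hW0, hU.1.initial])
        ⟨ht0, htr'.le⟩
  exact ⟨hlt, hW.eqOn hA.1 hF hS.le (hh S) (hU.1.solution S hS hlt)
    (by rw [hW0, hU.1.initial])⟩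

theorem exists_isMaximalGeneralizedSolution (hA : IsMaximalMonotoneOperator A)
    (hF : IsLocallyLipschitzMap F) {h : ℝ → H} (hh : ∀ T, IntegrableOn h (Icc 0 T)) {U₀ : H}
    (hU₀ : U₀ ∈ closure (operatorDomain A)) :
    ∃ T U, IsMaximalGeneralizedSolution A F h U₀ T U := by
  set P : ℝ → Prop := fun S => 0 < S ∧
    ∃ W : ℝ → H, W 0 = U₀ ∧ IsGeneralizedSolution A F h S W with hP
  set T : EReal := sSup ((fun S : ℝ => (S : EReal)) '' {S | P S}) with hT
  have hle : ∀ S, P S → (S : EReal) ≤ T := fun S hS => le_sSup ⟨S, hS, rfl⟩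
  have hex : ∀ t : ℝ, (t : EReal) < T → ∃ S, t < S ∧ P S := by
    intro t ht
    obtain ⟨_, ⟨S, hS, rfl⟩, hlt⟩ := lt_sSup_iff.1 ht
    exact ⟨S, EReal.coe_lt_coe_iff.1 hlt, hS⟩
  have hTpos : 0 < T := by
    obtain ⟨S, hS, hSP⟩ := exists_isGeneralizedSolution_local hA hF hh hU₀
    exact (EReal.coe_pos.2 hS).trans_le (hle S ⟨hS, hSP⟩)
  -- For each `t < T`, `σ t` is a later time up to which some solution exists. The values `W (σ t)
  -- t` do not depend on that choice by uniqueness, so they glue.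
  choose! σ hσ hσP using hex
  choose! W hW0 hW using fun S (hS : P S) => hS.2
  have hagree : ∀ S S' t, P S → P S' → 0 ≤ t → t ≤ S → t ≤ S' → W S t = W S' t := by
    intro S S' t hS hS' ht htS htS'
    exact ((hW S hS).mono (hh _) htS).eqOn hA.1 hF ht (hh t) ((hW S' hS').mono (hh _) htS')
      ((hW0 S hS).trans (hW0 S' hS').symm) (right_mem_Icc.2 ht)
  refine ⟨T, fun t => W (σ t) t, ⟨hTpos, ?_, fun s hs hsT => ?_⟩, fun S V hTS hV _ => ?_⟩
  · exact hW0 _ (hσP 0 (by exact_mod_cast hTpos))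
  · have hPs := hσP s hsT
    refine ((hW _ hPs).mono (hh _) (hσ s hsT).le).congr fun t ht => ?_
    have htT : (t : EReal) < T := (EReal.coe_le_coe_iff.2 ht.2).trans_lt hsT
    exact hagree _ _ t hPs (hσP t htT) ht.1 (ht.2.trans (hσ s hsT).le) (hσ t htT).le
  · by_contra hne
    obtain ⟨r, hTr, hrS⟩ := EReal.lt_iff_exists_real_btwn.1 (lt_of_le_of_ne hTS (Ne.symm hne))
    have hr : 0 < r := EReal.coe_pos.1 (hTpos.trans hTr)
    exact (hle r ⟨hr, V, hV.initial, hV.solution r hr hrS⟩).not_gt hTr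

theorem hasUniqueMaximalGeneralizedSolution (hA : IsMaximalMonotoneOperator A)
    (hF : IsLocallyLipschitzMap F) {h : ℝ → H} (hh : ∀ T, IntegrableOn h (Icc 0 T)) {U₀ : H}
    (hU₀ : U₀ ∈ closure (operatorDomain A)) :
    HasUniqueMaximalGeneralizedSolution A F h U₀ := by
  have hmono : ∀ {S T : EReal} {U V : ℝ → H}, IsMaximalGeneralizedSolution A F h U₀ T U →
      IsMaximalGeneralizedSolution A F h U₀ S V → S ≤ T := by
    intro S T U V hU hV
    by_contra! hlt
    obtain ⟨r, hTr, hrS⟩ := EReal.lt_iff_exists_real_btwn.1 hlt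
    have hr : 0 < r := EReal.coe_pos.1 (hU.1.pos.trans hTr)
    exact (hU.lt_and_eqOn hA hF hh hr (hV.1.solution r hr hrS) hV.1.initial).1.not_gt hTr
  obtain ⟨T, U, hU⟩ := exists_isMaximalGeneralizedSolution hA hF hh hU₀
  refine ⟨T, U, hU, fun S V hV => ?_⟩
  have hST : S = T := le_antisymm (hmono hU hV) (hmono hV hU)
  refine ⟨hST, fun t ht htT => ?_⟩
  obtain ⟨r, htr, hrT⟩ := EReal.lt_iff_exists_real_btwn.1 htT
  have htr' := EReal.coe_lt_coe_iff.1 htr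
  have hr : 0 < r := ht.trans_lt htr'
  exact (hU.lt_and_eqOn hA hF hh hr (hV.1.solution r hr (hST ▸ hrT)) hV.1.initial).2 ⟨ht, htr'.le⟩

end LocallyLipschitzPerturbation

theorem theoremA2 {H : Type*} [NormedAddCommGroup H] [InnerProductSpace ℝ H] [CompleteSpace H]
    (A : H → Set H) (hA : IsMaximalMonotoneOperator A) (hA0 : (0 : H) ∈ A 0)
    (F : H → H) (hF : IsLocallyLipschitzMap F)
    (U₀ : H) (hU₀ : U₀ ∈ closure (operatorDomain A))
    (V₀ : ℕ → H) (hV₀ : ∀ n, V₀ n ∈ closure (operatorDomain A))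
    (hV₀_lim : Tendsto V₀ atTop (𝓝 U₀))
    (h : ℝ → H) (hh : LocallyIntegrableOn h (Ici 0))
    (k : ℕ → ℝ → H) (hk : ∀ n, LocallyIntegrableOn (k n) (Ici 0))
    (hk_lim : ∀ T : ℝ, 0 < T →
      Tendsto (fun n => ∫ t in Icc 0 T, ‖k n t - h t‖) atTop (𝓝 0)) :
    HasUniqueMaximalGeneralizedSolution A F h U₀ ∧
    (∀ n, HasUniqueMaximalGeneralizedSolution A F (k n) (V₀ n)) ∧
    ∀ (Tmax : EReal) (U : ℝ → H) (τ : ℕ → EReal) (V : ℕ → ℝ → H),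
      IsMaximalGeneralizedSolution A F h U₀ Tmax U →
      (∀ n, IsMaximalGeneralizedSolution A F (k n) (V₀ n) (τ n) (V n)) →
      Tmax ≤ liminf τ atTop ∧
      ∀ T : ℝ, 0 < T → (T : EReal) < Tmax →
        (∀ᶠ n in atTop, (T : EReal) < τ n) ∧ TendstoUniformlyOn V U atTop (Icc 0 T) := by
  have hint : ∀ {g : ℝ → H}, LocallyIntegrableOn g (Ici 0) → ∀ T, IntegrableOn g (Icc 0 T) :=
    fun hg T => hg.integrableOn_compact_subset Icc_subset_Ici_self isCompact_Icc
  refine ⟨hasUniqueMaximalGeneralizedSolution hA hF (hint hh) hU₀,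
    fun n => hasUniqueMaximalGeneralizedSolution hA hF (hint (hk n)) (hV₀ n),
    fun Tmax U τ V hU hV => ?_⟩
  have hmain : ∀ T : ℝ, 0 < T → (T : EReal) < Tmax →
      (∀ᶠ n in atTop, (T : EReal) < τ n) ∧ TendstoUniformlyOn V U atTop (Icc 0 T) := by
    intro T hT hTmax
    obtain ⟨W, hW0, hWU, hW⟩ := (hU.1.solution T hT hTmax).exists_tendstoUniformlyOn hA hF hT.le
      (hint hh T) hV₀ (by rwa [hU.1.initial]) (fun n => hint (hk n) T) (hk_lim T hT)
    have hext : ∀ᶠ n in atTop, (T : EReal) < τ n ∧ EqOn (W n) (V n) (Icc 0 T) := by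
      filter_upwards [hW] with n hn
      exact (hV n).lt_and_eqOn hA hF (hint (hk n)) hT hn (hW0 n)
    exact ⟨hext.mono fun _ hn => hn.1, hWU.congr (hext.mono fun _ hn => hn.2)⟩
  refine ⟨?_, hmain⟩
  by_contra! hlt
  -- The maximum with `0` makes the intermediate time positive, as `hmain` requires.
  obtain ⟨T, hT, hTmax⟩ := EReal.lt_iff_exists_real_btwn.1 (max_lt hlt hU.1.pos)
  have hT0 : 0 < T := EReal.coe_pos.1 ((le_max_right _ _).trans_lt hT)
  exact (le_liminf_of_le (by isBoundedDefault) ((hmain T hT0 hTmax).1.mono fun _ hn => hn.le)).not_gt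
    ((le_max_left _ _).trans_lt hT)
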